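/- All Euclidean spaces are finite-dimensional and real. A \emph{$0$-symmetric convex body} in a Euclidean space $\mathbb E$ is a compact convex set $P=-P\subset\mathbb E$ with nonempty interior; $g_P$ is its gauge, a norm with unit ball $P$, and $C^\circ=\{y:\langle x,y\rangle\le 1\ \forall x\in C\}$ is the polar of $C\subset\mathbb E$. The space $\mathbb E_1\otimes\mathbb E_2$ carries the inner product determined by $\langle x\otimes y,x'\otimes y'\rangle=\langle x,x'\rangle\langle y,y'\rangle$. Put $$P_1\otimes_\pi P_2=\mathrm{conv}\{x\otimes y:x\in P_1,\,y\in P_2\},\qquad P_1\otimes_\epsilon P_2=(P_1^\circ\otimes_\pi P_2^\circ)^\circ .$$ A \emph{tensor product} $\otimes_\alpha$ of $0$-symmetric convex bodies assigns to every pair of $0$-symmetric convex bodies $P_i\subset\mathbb E_i$ ($i=1,2$) a $0$-symmetric convex body $P_1\otimes_\alpha P_2\subset\mathbb E_1\otimes\mathbb E_2$ such that $P_1\otimes_\pi P_2\subset P_1\otimes_\alpha P_2\subset P_1\otimes_\epsilon P_2$, and such that $(T_1\otimes T_2)(P_1\otimes_\alpha P_2)\subset Q_1\otimes_\alpha Q_2$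 whenever $T_i:\mathbb E_i\to\mathbb F_i$ are linear maps and $Q_i\subset\mathbb F_i$ are $0$-symmetric convex bodies with $T_i(P_i)\subset Q_i$. It is \emph{injective} if $(P_1\cap M_1)\otimes_\alpha(P_2\cap M_2)=(P_1\otimes_\alpha P_2)\cap(M_1\otimes M_2)$ for all $0$-symmetric convex bodies $P_i\subset\mathbb E_i$ and all subspaces $M_i\subset\mathbb E_i$ (with the induced inner products). Its dual is $P_1\otimes_{\alpha'}P_2=(P_1^\circ\otimes_\alpha P_2^\circ)^\circ$. Its injective hull $\otimes_{\alpha^{inj}}$ is given by letting $P_1\otimes_{\alpha^{inj}}P_2$ be the intersection of the bodies $P_1\otimes_\beta P_2$ over all injective tensor products $\otimes_\beta$ of $0$-symmetric convex bodies with $Q_1\otimes_\alpha Q_2\subset Q_1\otimes_\beta Q_2$ for all $0$-symmetric convex bodies $Q_1,Q_2$; its projective hull is $\otimes_{\alpha^{proj}}=\otimes_{((\alpha')^{inj})'}$. For $u=\sum_k x_k\otimes y_k\in\mathbb E_1\otimes\mathbb E_2$ let $T_u:(\mathbb E_1,g_{P_1})^*\to(\mathbb E_2,g_{P_2})$ be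 the map $T_u(\varphi)=\sum_k\varphi(x_k)y_k$, and let $\omega_2(u)=\inf\|R\|\,\|S\|$, where the infimum is over all factorizations $T_u=RS$ into bounded linear maps through a real Hilbert space. The Hilbertian tensor product is $P_1\otimes_{\omega_2}P_2=\{u:\omega_2(u)\le 1\}$, and $\otimes_{\omega_2'}$ is its dual. The real Grothendieck constant $K_G$ is the least $K$ such that for all $m,n$, every real $m\times n$ matrix $(a_{ij})$ with $|\sum_{i,j}a_{ij}s_it_j|\le1$ for all $s_i,t_j\in[-1,1]$, and all vectors $x_i,y_j$ in the closed unit ball of a real Hilbert space, $|\sum_{i,j}a_{ij}\langle x_i,y_j\rangle|\le K$. \textbf{Corollary.} For every pair of $0$-symmetric convex bodies $P_i\subset\mathbb E_i$, $i=1,2$, $$P_1\otimes_{\omega_2'}P_2\ \subset\ P_1\otimes_{\epsilon^{proj}}P_2\ \subset\ K_G\,(P_1\otimes_{\omega_2'}P_2).$$ -/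

import Mathlib

open scoped TensorProduct Pointwise

universe u

noncomputable section

namespace TensorBody

/-- A `0`-symmetric convex body: a compact convex set with nonempty interior and `P = -P`. -/
structure IsSymmBody {E : Type*} [NormedAddCommGroup E] [InnerProductSpace ℝ E] (P : Set E) :
    Prop where
  convex : Convex ℝ P
  isCompact : IsCompact P
  nonempty_interior : (interior P).Nonempty
  neg_eq : -P = P

/-- The polar set `{y | sup_{x ∈ C} ⟪x, y⟫ ≤ 1}` with respect to the inner product. -/
def polar {E : Type*} [NormedAddCommGroup E] [InnerProductSpace ℝ E] (C : Set E) : Set E :=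
  {y | ∀ x ∈ C, inner ℝ x y ≤ 1}

/-- The raw data of a product of order two: a set `α E₁ E₂ P₁ P₂ ⊆ E₁ ⊗ E₂` for all Euclidean
spaces `E₁`, `E₂` and all `P₁ ⊆ E₁`, `P₂ ⊆ E₂`. Only the values at `0`-symmetric convex bodies are
ever used. The space `E₁ ⊗ E₂` carries the Hilbert tensor product structure, for which
`⟪x ⊗ y, x' ⊗ y'⟫ = ⟪x, x'⟫ * ⟪y, y'⟫`. -/
abbrev BodyProduct : Type (u + 1) :=
  ∀ (E₁ E₂ : Type u)
    [NormedAddCommGroup E₁] [InnerProductSpace ℝ E₁] [FiniteDimensional ℝ E₁]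
    [NormedAddCommGroup E₂] [InnerProductSpace ℝ E₂] [FiniteDimensional ℝ E₂],
    Set E₁ → Set E₂ → Set (E₁ ⊗[ℝ] E₂)

/-- The projective tensor product `conv {x ⊗ y : x ∈ P₁, y ∈ P₂}`. -/
def projective : BodyProduct.{u} := fun _ _ _ _ _ _ _ _ P₁ P₂ =>
  convexHull ℝ {z | ∃ x ∈ P₁, ∃ y ∈ P₂, z = x ⊗ₜ[ℝ] y}

/-- The dual product `(P₁° ⊗_α P₂°)°`. -/
def dual (α : BodyProduct.{u}) : BodyProduct.{u} := fun E₁ E₂ _ _ _ _ _ _ P₁ P₂ =>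
  polar (α E₁ E₂ (polar P₁) (polar P₂))

/-- The injective tensor product `(P₁° ⊗_π P₂°)°`. -/
def injective : BodyProduct.{u} := fun E₁ E₂ _ _ _ _ _ _ P₁ P₂ =>
  polar (projective E₁ E₂ (polar P₁) (polar P₂))

/-- The order on products: `P₁ ⊗_α P₂ ⊆ P₁ ⊗_β P₂` for all `0`-symmetric convex bodies. -/
def Below (α β : BodyProduct.{u}) : Prop :=
  ∀ (E₁ E₂ : Type u)
    [NormedAddCommGroup E₁] [InnerProductSpace ℝ E₁] [FiniteDimensional ℝ E₁]
    [NormedAddCommGroup E₂] [InnerProductSpace ℝ E₂] [FiniteDimensional ℝ E₂]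
    (P₁ : Set E₁) (P₂ : Set E₂), IsSymmBody P₁ → IsSymmBody P₂ → α E₁ E₂ P₁ P₂ ⊆ β E₁ E₂ P₁ P₂

/-- `α` is a tensor product (of order two) of `0`-symmetric convex bodies. -/
structure IsTensorProduct (α : BodyProduct.{u}) : Prop where
  isSymmBody : ∀ (E₁ E₂ : Type u)
    [NormedAddCommGroup E₁] [InnerProductSpace ℝ E₁] [FiniteDimensional ℝ E₁]
    [NormedAddCommGroup E₂] [InnerProductSpace ℝ E₂] [FiniteDimensional ℝ E₂]
    (P₁ : Set E₁) (P₂ : Set E₂), IsSymmBody P₁ → IsSymmBody P₂ → IsSymmBody (α E₁ E₂ P₁ P₂)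
  projective_below : Below projective α
  below_injective : Below α injective
  uniform : ∀ (E₁ E₂ F₁ F₂ : Type u)
    [NormedAddCommGroup E₁] [InnerProductSpace ℝ E₁] [FiniteDimensional ℝ E₁]
    [NormedAddCommGroup E₂] [InnerProductSpace ℝ E₂] [FiniteDimensional ℝ E₂]
    [NormedAddCommGroup F₁] [InnerProductSpace ℝ F₁] [FiniteDimensional ℝ F₁]
    [NormedAddCommGroup F₂] [InnerProductSpace ℝ F₂] [FiniteDimensional ℝ F₂]
    (T₁ : E₁ →ₗ[ℝ] F₁) (T₂ : E₂ →ₗ[ℝ] F₂)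
    (P₁ : Set E₁) (P₂ : Set E₂) (Q₁ : Set F₁) (Q₂ : Set F₂),
    IsSymmBody P₁ → IsSymmBody P₂ → IsSymmBody Q₁ → IsSymmBody Q₂ →
    T₁ '' P₁ ⊆ Q₁ → T₂ '' P₂ ⊆ Q₂ →
    TensorProduct.map T₁ T₂ '' α E₁ E₂ P₁ P₂ ⊆ α F₁ F₂ Q₁ Q₂

/-- `α` respects sections: `(P₁ ∩ M₁) ⊗_α (P₂ ∩ M₂) = (P₁ ⊗_α P₂) ∩ (M₁ ⊗ M₂)` for all subspaces
`M₁`, `M₂` with the induced inner products. The set `P ∩ M`, seen in the Euclidean space `M`, is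
the preimage of `P` under the inclusion, and `M₁ ⊗ M₂` is identified with its image in
`E₁ ⊗ E₂`. -/
def IsInjective (α : BodyProduct.{u}) : Prop :=
  ∀ (E₁ E₂ : Type u)
    [NormedAddCommGroup E₁] [InnerProductSpace ℝ E₁] [FiniteDimensional ℝ E₁]
    [NormedAddCommGroup E₂] [InnerProductSpace ℝ E₂] [FiniteDimensional ℝ E₂]
    (P₁ : Set E₁) (P₂ : Set E₂) (M₁ : Submodule ℝ E₁) (M₂ : Submodule ℝ E₂),
    IsSymmBody P₁ → IsSymmBody P₂ →
    TensorProduct.mapIncl M₁ M₂ '' α M₁ M₂ (M₁.subtype ⁻¹' P₁) (M₂.subtype ⁻¹' P₂) =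
      α E₁ E₂ P₁ P₂ ∩ Set.range (TensorProduct.mapIncl M₁ M₂)

/-- The injective hull `α^inj`: the intersection of all injective tensor products of `0`-symmetric
convex bodies that lie above `α`. -/
def injHull (α : BodyProduct.{u}) : BodyProduct.{u} := fun E₁ E₂ _ _ _ _ _ _ P₁ P₂ =>
  {z | ∀ β : BodyProduct.{u}, IsTensorProduct β → IsInjective β → Below α β → z ∈ β E₁ E₂ P₁ P₂}

/-- The projective hull `α^proj = ((α')^inj)'`. -/
def projHull (α : BodyProduct.{u}) : BodyProduct.{u} := dual (injHull (dual α))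

/-- The norm on the dual of `(E, g_P)`. -/
def dualNorm {E : Type*} [NormedAddCommGroup E] [InnerProductSpace ℝ E] (P : Set E)
    (φ : Module.Dual ℝ E) : ℝ :=
  sSup ((fun x => |φ x|) '' P)

/-- The linear map `T_u : E₁* → E₂`, `φ ↦ ∑ i, φ (x i) • y i`, of `u = ∑ i, x i ⊗ y i`. -/
def tensorToHom (E₁ E₂ : Type*) [AddCommGroup E₁] [Module ℝ E₁] [AddCommGroup E₂] [Module ℝ E₂] :
    E₁ ⊗[ℝ] E₂ →ₗ[ℝ] Module.Dual ℝ E₁ →ₗ[ℝ] E₂ :=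
  dualTensorHom ℝ (Module.Dual ℝ E₁) E₂ ∘ₗ
    TensorProduct.map (Module.Dual.eval ℝ E₁) LinearMap.id

/-- The Hilbertian tensor norm `ω₂` on `(E₁, g_{P₁}) ⊗ (E₂, g_{P₂})`: the infimum of `‖R‖ * ‖S‖`
over all factorizations `T_u = R ∘ S` of `T_u : (E₁, g_{P₁})* → (E₂, g_{P₂})` through a Hilbert
space `H`. Here `a` and `b` run over the bounds of the operators `S` and `R`, so that an unbounded
`R` does not occur. -/
def hilbertianNorm {E₁ E₂ : Type u}
    [NormedAddCommGroup E₁] [InnerProductSpace ℝ E₁]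
    [NormedAddCommGroup E₂] [InnerProductSpace ℝ E₂]
    (P₁ : Set E₁) (P₂ : Set E₂) (z : E₁ ⊗[ℝ] E₂) : ℝ :=
  sInf {c | ∃ (H : Type u) (_ : NormedAddCommGroup H) (_ : InnerProductSpace ℝ H)
    (_ : CompleteSpace H) (S : Module.Dual ℝ E₁ →ₗ[ℝ] H) (R : H →ₗ[ℝ] E₂) (a b : ℝ),
    0 ≤ a ∧ 0 ≤ b ∧ (∀ φ, ‖S φ‖ ≤ a * dualNorm P₁ φ) ∧ (∀ h, gauge P₂ (R h) ≤ b * ‖h‖) ∧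
    tensorToHom E₁ E₂ z = R ∘ₗ S ∧ c = b * a}

/-- The Hilbertian tensor product of bodies `⊗_{ω₂}`: the closed unit ball of `ω₂`. -/
def hilbertian : BodyProduct.{u} := fun _ _ _ _ _ _ _ _ P₁ P₂ => {z | hilbertianNorm P₁ P₂ z ≤ 1}

/-- The (real) Grothendieck constant `K_G`: the least `K` such that, for every real matrix `A` with
`|∑ i j, A i j * s i * t j| ≤ 1` for all `s i, t j ∈ [-1, 1]`, one has
`|∑ i j, A i j * ⟪x i, y j⟫| ≤ K` for all `x i, y j` in the unit ball of any real Hilbert space. -/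
def grothendieckConstant : ℝ :=
  sInf {K | ∀ (m n : ℕ) (A : Matrix (Fin m) (Fin n) ℝ),
    (∀ (s : Fin m → ℝ) (t : Fin n → ℝ), (∀ i, |s i| ≤ 1) → (∀ j, |t j| ≤ 1) →
      |∑ i, ∑ j, A i j * s i * t j| ≤ 1) →
    ∀ (H : Type) [NormedAddCommGroup H] [InnerProductSpace ℝ H] [CompleteSpace H]
      (x : Fin m → H) (y : Fin n → H), (∀ i, ‖x i‖ ≤ 1) → (∀ j, ‖y j‖ ≤ 1) →
      |∑ i, ∑ j, A i j * inner ℝ (x i) (y j)| ≤ K}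

end TensorBody

end

/-! The upper half of the projective hull of `injective` is governed by all injective products `β`,
the lower half by one of them. By the bipolar theorem `dual injective` is the bipolar of the
projective product. Hence, once `hilbertian` is known to be an injective tensor product
(`isTensorProduct_hilbertian`, `isInjective_hilbertian`), it is a competitor in the injective hull
of `dual injective`; it contains that hull, and polarity gives the first inclusion.

For the second inclusion, `smul_mem_of_mem_hilbertian` shows that every injective tensor product `β`
contains the Hilbertian body shrunk by the Grothendieck constant. On two cubes this needs only that
`β` contains the projective product: by duality it is Grothendieck's inequality, since a functional
bounded by one on the projective product of cubes is a matrix contracting the cubes, and the unit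
vectors lie in the polar of a cube. An arbitrary body is, up to a factor close to one, a section of
a cube (`exists_cube_embedding`), so injectivity of `β` carries the estimate over.

The Hilbertian norm is handled through `GramFactors`, a Gram representation of the bilinear form of
a tensor. Its stability under restriction to subspaces, `gramFactors_of_mapIncl`, is the core of
injectivity. Since `grothendieckConstant` is an infimum, Grothendieck's inequality must be proved
with some finite constant; truncated Rademacher sums give 98. -/

noncomputable section

namespace TensorBody

/-! ### Polars, sections and gauges of symmetric bodies -/

section Polar

variable {E F : Type*} [NormedAddCommGroup E] [InnerProductSpace ℝ E]
  [NormedAddCommGroup F] [InnerProductSpace ℝ F]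

lemma subset_polar_polar (C : Set E) : C ⊆ polar (polar C) := fun x hx y hy => by
  rw [real_inner_comm]
  exact hy x hx

lemma polar_anti {C D : Set E} (h : C ⊆ D) : polar D ⊆ polar C := fun _ hy x hx => hy x (h hx)

lemma zero_mem_polar (C : Set E) : (0 : E) ∈ polar C := fun x _ => by simp

lemma convex_polar (C : Set E) : Convex ℝ (polar C) := by
  intro y hy z hz a b ha hb hab x hx
  rw [inner_add_right, inner_smul_right, inner_smul_right]
  nlinarith [hy x hx, hz x hx]

lemma isClosed_polar (C : Set E) : IsClosed (polar C) := by
  have : polar C = ⋂ x ∈ C, {y | inner ℝ x y ≤ 1} := by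
    ext y
    simp [polar]
  rw [this]
  exact isClosed_biInter fun x _ => isClosed_le (by fun_prop) continuous_const

/-- The bipolar theorem. -/
lemma polar_polar [CompleteSpace E] {C : Set E} (hc : Convex ℝ C) (hcl : IsClosed C)
    (h0 : (0 : E) ∈ C) : polar (polar C) = C := by
  refine Set.Subset.antisymm (fun x hx => ?_) (subset_polar_polar C)
  by_contra hxC
  obtain ⟨f, r, hfr, hrx⟩ := geometric_hahn_banach_closed_point hc hcl hxC
  have hr : 0 < r := by simpa using hfr 0 h0
  set v := (InnerProductSpace.toDual ℝ E).symm f with hv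
  have hfv : ∀ y, f y = inner ℝ v y := fun y => by
    rw [hv, InnerProductSpace.toDual_symm_apply]
  have hmem : r⁻¹ • v ∈ polar C := fun y hy => by
    rw [inner_smul_right, real_inner_comm, ← hfv, inv_mul_le_iff₀ hr, mul_one]
    exact (hfr y hy).le
  have := hx _ hmem
  rw [real_inner_smul_left, ← hfv, inv_mul_le_iff₀ hr, mul_one] at this
  exact absurd hrx (not_lt.mpr this)

lemma IsSymmBody.neg_mem {P : Set E} (hP : IsSymmBody P) {x : E} (hx : x ∈ P) : -x ∈ P := by
  rw [← hP.neg_eq]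
  simpa using hx

lemma IsSymmBody.zero_mem_interior {P : Set E} (hP : IsSymmBody P) : (0 : E) ∈ interior P := by
  obtain ⟨x, hx⟩ := hP.nonempty_interior
  have hx' : -x ∈ interior P := by
    have h := (Homeomorph.neg E).preimage_interior P
    have h2 : (Homeomorph.neg E) ⁻¹' P = P := hP.neg_eq
    rw [h2] at h
    rw [← h] at hx
    exact hx
  have := hP.convex.interior hx hx' (a := 1 / 2) (b := 1 / 2) (by norm_num) (by norm_num)
    (by norm_num)
  simpa using this

lemma IsSymmBody.zero_mem {P : Set E} (hP : IsSymmBody P) : (0 : E) ∈ P :=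
  interior_subset hP.zero_mem_interior

lemma IsSymmBody.exists_closedBall_subset {P : Set E} (hP : IsSymmBody P) :
    ∃ r > 0, Metric.closedBall (0 : E) r ⊆ P :=
  Metric.nhds_basis_closedBall.mem_iff.mp (mem_interior_iff_mem_nhds.mp hP.zero_mem_interior)

lemma IsSymmBody.exists_norm_le {P : Set E} (hP : IsSymmBody P) :
    ∃ R > 0, ∀ x ∈ P, ‖x‖ ≤ R := by
  obtain ⟨R, hR⟩ := hP.isCompact.isBounded.exists_norm_le
  exact ⟨max R 1, by positivity, fun x hx => (hR x hx).trans (le_max_left _ _)⟩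

lemma IsSymmBody.smul_mem {P : Set E} (hP : IsSymmBody P) {x : E} (hx : x ∈ P) {t : ℝ}
    (ht : |t| ≤ 1) : t • x ∈ P := by
  rcases le_total 0 t with h | h
  · exact hP.convex.starConvex hP.zero_mem |>.smul_mem hx h (by rwa [abs_of_nonneg h] at ht)
  · have := hP.convex.starConvex hP.zero_mem |>.smul_mem (hP.neg_mem hx) (neg_nonneg.mpr h)
      (by rwa [abs_of_nonpos h] at ht)
    simpa using this

lemma IsSymmBody.polar_polar [CompleteSpace E] {P : Set E} (hP : IsSymmBody P) :
    polar (polar P) = P :=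
  TensorBody.polar_polar hP.convex hP.isCompact.isClosed hP.zero_mem

lemma IsSymmBody.abs_inner_le_one {P : Set E} (hP : IsSymmBody P) {x y : E} (hx : x ∈ P)
    (hy : y ∈ TensorBody.polar P) : |inner ℝ x y| ≤ 1 := by
  refine abs_le.mpr ⟨?_, hy x hx⟩
  have := hy (-x) (hP.neg_mem hx)
  rw [inner_neg_left] at this
  linarith

lemma isSymmBody_of_closedBall [FiniteDimensional ℝ E] {P : Set E} (hc : Convex ℝ P)
    (hcl : IsClosed P) (hneg : ∀ x ∈ P, -x ∈ P) {r R : ℝ} (hr : 0 < r)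
    (hball : Metric.closedBall (0 : E) r ⊆ P) (hR : ∀ x ∈ P, ‖x‖ ≤ R) : IsSymmBody P where
  convex := hc
  isCompact := by
    have : ProperSpace E := FiniteDimensional.proper ℝ E
    refine Metric.isCompact_of_isClosed_isBounded hcl (isBounded_iff_forall_norm_le.mpr ⟨R, hR⟩)
  nonempty_interior := ⟨0, mem_interior_iff_mem_nhds.mpr
    (Filter.mem_of_superset (Metric.closedBall_mem_nhds 0 hr) hball)⟩
  neg_eq := by
    ext x
    exact ⟨fun hx => by simpa using hneg _ hx, fun hx => hneg _ hx⟩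

lemma IsSymmBody.polar [FiniteDimensional ℝ E] {P : Set E} (hP : IsSymmBody P) :
    IsSymmBody (polar P) := by
  obtain ⟨r, hr, hball⟩ := hP.exists_closedBall_subset
  obtain ⟨R, hR, hb⟩ := hP.exists_norm_le
  refine isSymmBody_of_closedBall (r := R⁻¹) (R := r⁻¹) (convex_polar P) (isClosed_polar P) ?_
    (by positivity) ?_ ?_
  · intro y hy x hx
    have := hy (-x) (hP.neg_mem hx)
    rwa [inner_neg_left, ← inner_neg_right] at this
  · intro y hy x hx
    have hy' : ‖y‖ ≤ R⁻¹ := by simpa using hy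
    calc inner ℝ x y ≤ ‖x‖ * ‖y‖ := real_inner_le_norm x y
      _ ≤ R * R⁻¹ := mul_le_mul (hb x hx) hy' (norm_nonneg _) hR.le
      _ = 1 := mul_inv_cancel₀ hR.ne'
  · intro y hy
    rcases eq_or_ne y 0 with rfl | h0
    · simpa using hr.le
    have hn : 0 < ‖y‖ := norm_pos_iff.mpr h0
    -- Testing against the multiple of `y` of norm `r` bounds `‖y‖` by `r⁻¹`.
    have := hy ((r / ‖y‖) • y) (hball (by
      rw [mem_closedBall_zero_iff, norm_smul, Real.norm_of_nonneg (by positivity)]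
      field_simp
      rfl))
    rw [real_inner_smul_left, real_inner_self_eq_norm_sq] at this
    have h2 : r / ‖y‖ * ‖y‖ ^ 2 = r * ‖y‖ := by field_simp
    rw [h2] at this
    rwa [← one_div, le_div_iff₀' hr]

lemma IsSymmBody.preimage [FiniteDimensional ℝ E] [FiniteDimensional ℝ F] {P : Set F}
    (hP : IsSymmBody P) (T : E →ₗ[ℝ] F) (hT : Function.Injective T) : IsSymmBody (T ⁻¹' P) := by
  obtain ⟨K, hK, hanti⟩ := T.exists_antilipschitzWith (LinearMap.ker_eq_bot.mpr hT)
  have hcont : Continuous T := T.continuous_of_finiteDimensional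
  have hnhds : T ⁻¹' P ∈ nhds (0 : E) := hcont.continuousAt.preimage_mem_nhds (by
    rw [map_zero]
    exact mem_interior_iff_mem_nhds.mp hP.zero_mem_interior)
  obtain ⟨r, hr, hball⟩ := Metric.nhds_basis_closedBall.mem_iff.mp hnhds
  obtain ⟨R, hR, hb⟩ := hP.exists_norm_le
  refine isSymmBody_of_closedBall (R := K * R) (hP.convex.linear_preimage T)
    (hP.isCompact.isClosed.preimage hcont) ?_ hr hball ?_
  · intro x hx
    simpa using hP.neg_mem hx
  · intro x hx
    have := hanti.le_mul_dist x 0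
    simp only [map_zero, dist_zero_right] at this
    exact this.trans (by gcongr; exact hb _ hx)

/-- Polars of sections are projections of polars. -/
lemma exists_mem_polar_sub_mem_orthogonal [FiniteDimensional ℝ E] {P : Set E} (hP : IsSymmBody P)
    (M : Submodule ℝ E) {m : M} (hm : m ∈ polar (M.subtype ⁻¹' P)) :
    ∃ x ∈ polar P, x - m ∈ Mᗮ := by
  set p : E →L[ℝ] M := M.orthogonalProjectionOnto with hp
  -- The projection of the compact set `polar P` is closed and convex, so computing its polar
  -- suffices: the bipolar theorem inside `M` then recovers it.
  have hpolar : polar (p '' polar P) = M.subtype ⁻¹' P := by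
    ext y
    have h : y ∈ M.subtype ⁻¹' P ↔ (y : E) ∈ polar (polar P) := by rw [hP.polar_polar]; rfl
    rw [h]
    refine Set.forall_mem_image.trans (forall₂_congr fun x hx => ?_)
    rw [hp, Submodule.inner_orthogonalProjectionOnto_eq_of_mem_right]
  have : m ∈ polar (polar (p '' polar P)) := by rwa [hpolar]
  have hconv : Convex ℝ (p '' polar P) := (convex_polar P).linear_image p.toLinearMap
  rw [TensorBody.polar_polar hconv
    (hP.polar.isCompact.image p.continuous).isClosed ⟨0, zero_mem_polar P, map_zero p⟩] at this
  obtain ⟨x, hx, rfl⟩ := this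
  exact ⟨x, hx, M.sub_starProjection_mem_orthogonal x⟩

lemma IsSymmBody.gauge_le_iff [CompleteSpace E] {P : Set E} (hP : IsSymmBody P) {x : E} {r : ℝ}
    (hr : 0 ≤ r) : gauge P x ≤ r ↔ ∀ y ∈ TensorBody.polar P, inner ℝ y x ≤ r := by
  have habs : Absorbent ℝ P :=
    absorbent_nhds_zero (mem_interior_iff_mem_nhds.mp hP.zero_mem_interior)
  constructor
  · intro h y hy
    refine le_of_forall_gt_imp_ge_of_dense fun s hs => ?_
    obtain ⟨t, ht, hts, z, hz, rfl⟩ := exists_lt_of_gauge_lt habs (h.trans_lt hs)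
    have := hy z hz
    rw [inner_smul_right]
    rw [real_inner_comm] at this
    nlinarith
  · intro h
    refine le_of_forall_gt_imp_ge_of_dense fun s hs => ?_
    have hs0 : 0 < s := hr.trans_lt hs
    refine gauge_le_of_mem hs0.le ((Set.mem_smul_set_iff_inv_smul_mem₀ hs0.ne' _ _).mpr ?_)
    rw [← hP.polar_polar]
    intro y hy
    rw [inner_smul_right, inv_mul_le_iff₀ hs0, mul_one]
    exact (h y hy).trans hs.le

end Polar

/-! ### Gram representations of tensors -/

section Gram

variable {E₁ E₂ F₁ F₂ : Type u}
  [NormedAddCommGroup E₁] [InnerProductSpace ℝ E₁] [NormedAddCommGroup E₂] [InnerProductSpace ℝ E₂]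
  [NormedAddCommGroup F₁] [InnerProductSpace ℝ F₁] [NormedAddCommGroup F₂] [InnerProductSpace ℝ F₂]

lemma inner_tensor_smul_right (w z : E₁ ⊗[ℝ] E₂) (t : ℝ) :
    inner ℝ w (t • z) = t * inner ℝ w z :=
  real_inner_smul_right w z t

/-- The bilinear form `(x, y) ↦ ⟪x ⊗ y, z⟫` factors through a Hilbert space by linear maps that are
bounded by `1` and `c` on the polars of `P₁` and `P₂`. -/
def GramFactors (P₁ : Set E₁) (P₂ : Set E₂) (z : E₁ ⊗[ℝ] E₂) (c : ℝ) : Prop :=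
  ∃ (H : Type u) (_ : NormedAddCommGroup H) (_ : InnerProductSpace ℝ H)
    (_ : CompleteSpace H) (A : E₁ →ₗ[ℝ] H) (B : E₂ →ₗ[ℝ] H),
    (∀ x ∈ polar P₁, ‖A x‖ ≤ 1) ∧ (∀ y ∈ polar P₂, ‖B y‖ ≤ c) ∧
    ∀ x y, inner ℝ (x ⊗ₜ[ℝ] y) z = inner ℝ (A x) (B y)

lemma GramFactors.mono {P₁ : Set E₁} {P₂ : Set E₂} {z : E₁ ⊗[ℝ] E₂} {c d : ℝ}
    (h : GramFactors P₁ P₂ z c) (hcd : c ≤ d) : GramFactors P₁ P₂ z d := by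
  obtain ⟨H, _, _, _, A, B, hA, hB, hz⟩ := h
  exact ⟨H, _, _, ‹_›, A, B, hA, fun y hy => (hB y hy).trans hcd, hz⟩

lemma GramFactors.nonneg {P₁ : Set E₁} {P₂ : Set E₂} {z : E₁ ⊗[ℝ] E₂} {c : ℝ}
    (h : GramFactors P₁ P₂ z c) : 0 ≤ c := by
  obtain ⟨H, _, _, _, A, B, hA, hB, hz⟩ := h
  exact (norm_nonneg _).trans (hB 0 (zero_mem_polar _))

lemma GramFactors.smul {P₁ : Set E₁} {P₂ : Set E₂} {z : E₁ ⊗[ℝ] E₂} {c : ℝ}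
    (h : GramFactors P₁ P₂ z c) (t : ℝ) : GramFactors P₁ P₂ (t • z) (|t| * c) := by
  obtain ⟨H, _, _, _, A, B, hA, hB, hz⟩ := h
  refine ⟨H, _, _, ‹_›, A, t • B, hA, fun y hy => ?_, fun x y => ?_⟩
  · rw [LinearMap.smul_apply, norm_smul, Real.norm_eq_abs]
    gcongr
    exact hB y hy
  · rw [LinearMap.smul_apply, real_inner_smul_right, inner_tensor_smul_right, hz]

/-- In the `ℓ²`-sum of the two Hilbert spaces, weights `√s` and `√t` on both sides make the inner
product the convex combination, while each squared norm becomes a convex combination of squared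
norms. -/
lemma convex_gramFactors (P₁ : Set E₁) (P₂ : Set E₂) (c : ℝ) :
    Convex ℝ {z | GramFactors P₁ P₂ z c} := by
  intro z hz z' hz' s t hs ht hst
  have hc := GramFactors.nonneg hz
  obtain ⟨H, _, _, _, A, B, hA, hB, hz⟩ := hz
  obtain ⟨H', _, _, _, A', B', hA', hB', hz'⟩ := hz'
  have key : ∀ (u : H) (v : H') (d : ℝ), 0 ≤ d → ‖u‖ ≤ d → ‖v‖ ≤ d →
      ‖WithLp.toLp 2 (√s • u, √t • v)‖ ≤ d := by
    intro u v d hd hu hv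
    refine le_of_sq_le_sq ?_ hd
    rw [WithLp.prod_norm_sq_eq_of_L2]
    have e1 : ‖√s • u‖ ^ 2 = s * ‖u‖ ^ 2 := by
      rw [norm_smul, mul_pow, Real.norm_eq_abs, sq_abs, Real.sq_sqrt hs]
    have e2 : ‖√t • v‖ ^ 2 = t * ‖v‖ ^ 2 := by
      rw [norm_smul, mul_pow, Real.norm_eq_abs, sq_abs, Real.sq_sqrt ht]
    have e3 : ‖√s • u‖ ^ 2 + ‖√t • v‖ ^ 2 ≤ d ^ 2 := ?_
    · exact e3
    rw [e1, e2]
    have h1 : ‖u‖ ^ 2 ≤ d ^ 2 := by gcongr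
    have h2 : ‖v‖ ^ 2 ≤ d ^ 2 := by gcongr
    nlinarith
  let J := (WithLp.linearEquiv 2 ℝ (H × H')).symm.toLinearMap
  refine ⟨WithLp 2 (H × H'), inferInstance, inferInstance, inferInstance,
    J ∘ₗ (√s • A).prod (√t • A'), J ∘ₗ (√s • B).prod (√t • B'),
    fun x hx => key _ _ _ zero_le_one (hA x hx) (hA' x hx),
    fun y hy => key _ _ _ hc (hB y hy) (hB' y hy), fun x y => ?_⟩
  have e1 : ∀ x, (J ∘ₗ (√s • A).prod (√t • A')) x = WithLp.toLp 2 (√s • A x, √t • A' x) :=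
    fun _ => rfl
  have e2 : ∀ x, (J ∘ₗ (√s • B).prod (√t • B')) x = WithLp.toLp 2 (√s • B x, √t • B' x) :=
    fun _ => rfl
  have e3 : inner ℝ (x ⊗ₜ[ℝ] y) (s • z + t • z') = s * inner ℝ (A x) (B y)
      + t * inner ℝ (A' x) (B' y) := by
    rw [← hz, ← hz', inner_add_right, inner_tensor_smul_right, inner_tensor_smul_right]
  have e4 : inner ℝ (WithLp.toLp 2 (√s • A x, √t • A' x)) (WithLp.toLp 2 (√s • B y, √t • B' y)) =
      inner ℝ (√s • A x) (√s • B y) + inner ℝ (√t • A' x) (√t • B' y) :=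
    WithLp.prod_inner_apply _ _
  rw [e1, e2, e3, e4]
  simp only [real_inner_smul_left, real_inner_smul_right, ← mul_assoc, Real.mul_self_sqrt hs,
    Real.mul_self_sqrt ht]

lemma gramFactors_tmul {P₁ : Set E₁} {P₂ : Set E₂} (hP₁ : IsSymmBody P₁) (hP₂ : IsSymmBody P₂)
    {x : E₁} {y : E₂} (hx : x ∈ P₁) (hy : y ∈ P₂) : GramFactors P₁ P₂ (x ⊗ₜ y) 1 := by
  -- A one-dimensional Hilbert space living in the universe `u`.
  let e : EuclideanSpace ℝ PUnit.{u + 1} := EuclideanSpace.single PUnit.unit 1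
  have he : ‖e‖ = 1 := by simp [e]
  refine ⟨EuclideanSpace ℝ PUnit.{u + 1}, inferInstance, inferInstance, inferInstance,
    (innerₗ E₁ x).smulRight e, (innerₗ E₂ y).smulRight e, fun v hv => ?_, fun v hv => ?_,
    fun v w => ?_⟩
  · simpa [norm_smul, he] using hP₁.abs_inner_le_one hx hv
  · simpa [norm_smul, he] using hP₂.abs_inner_le_one hy hv
  · simp [inner_smul_left, inner_smul_right, he, real_inner_comm, mul_comm]

lemma projective_subset_gramFactors [FiniteDimensional ℝ E₁] [FiniteDimensional ℝ E₂]
    {P₁ : Set E₁} {P₂ : Set E₂} (hP₁ : IsSymmBody P₁) (hP₂ : IsSymmBody P₂) :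
    projective E₁ E₂ P₁ P₂ ⊆ {z | GramFactors P₁ P₂ z 1} := by
  refine convexHull_min ?_ (convex_gramFactors P₁ P₂ 1)
  rintro _ ⟨x, hx, y, hy, rfl⟩
  exact gramFactors_tmul hP₁ hP₂ hx hy

lemma exists_inner_tmul_eq (z : E₁ ⊗[ℝ] E₂) :
    ∃ B : E₂ →L[ℝ] E₁, ∀ x y, inner ℝ (x ⊗ₜ[ℝ] y) z = inner ℝ x (B y) := by
  induction z using TensorProduct.induction_on with
  | zero => exact ⟨0, by simp⟩
  | tmul u v =>
    refine ⟨(innerSL ℝ v).smulRight u, fun x y => ?_⟩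
    simp [inner_smul_right, real_inner_comm, mul_comm]
  | add z w hz hw =>
    obtain ⟨B, hB⟩ := hz
    obtain ⟨C, hC⟩ := hw
    exact ⟨B + C, fun x y => by simp [inner_add_right, hB, hC]⟩

lemma exists_gramFactors [FiniteDimensional ℝ E₁] [FiniteDimensional ℝ E₂]
    {P₁ : Set E₁} {P₂ : Set E₂} (hP₁ : IsSymmBody P₁) (hP₂ : IsSymmBody P₂) :
    ∃ C > 0, ∀ z : E₁ ⊗[ℝ] E₂, GramFactors P₁ P₂ z (C * ‖z‖) := by
  obtain ⟨R₁, hR₁, h₁⟩ := hP₁.polar.exists_norm_le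
  obtain ⟨R₂, hR₂, h₂⟩ := hP₂.polar.exists_norm_le
  refine ⟨R₁ * R₂, by positivity, fun z => ?_⟩
  obtain ⟨B, hB⟩ := exists_inner_tmul_eq z
  have hnorm : ∀ y, ‖B y‖ ≤ ‖y‖ * ‖z‖ := by
    intro y
    -- Cauchy–Schwarz in the tensor product, applied to `B y ⊗ y` and `z`.
    have h : inner ℝ (B y) (B y) ≤ ‖B y‖ * ‖y‖ * ‖z‖ := by
      rw [← hB, ← TensorProduct.norm_tmul (𝕜 := ℝ) (B y) y]
      exact real_inner_le_norm (B y ⊗ₜ[ℝ] y) z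
    rw [real_inner_self_eq_norm_sq] at h
    rcases (norm_nonneg (B y)).eq_or_lt with h0 | h0
    · rw [← h0]
      positivity
    · exact le_of_mul_le_mul_left (by linarith) h0
  refine ⟨E₁, inferInstance, inferInstance, FiniteDimensional.complete ℝ E₁,
    R₁⁻¹ • LinearMap.id, R₁ • B.toLinearMap, fun x hx => ?_, fun y hy => ?_, fun x y => ?_⟩
  · simp only [LinearMap.smul_apply, LinearMap.id_apply, norm_smul, norm_inv, Real.norm_eq_abs,
      abs_of_pos hR₁]
    rw [inv_mul_le_iff₀ hR₁, mul_one]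
    exact h₁ x hx
  · simp only [LinearMap.smul_apply, norm_smul, Real.norm_eq_abs, abs_of_pos hR₁]
    rw [mul_assoc]
    gcongr
    exact (hnorm y).trans (by gcongr; exact h₂ y hy)
  · rw [hB]
    simp only [LinearMap.smul_apply, LinearMap.id_apply, inner_smul_left, inner_smul_right]
    simp [hR₁.ne']

/-- Each coordinate of `z` in a product orthonormal basis is an inner product of images of basis
vectors, and these are controlled because both polars contain a ball. -/
lemma GramFactors.exists_norm_le [FiniteDimensional ℝ E₁] [FiniteDimensional ℝ E₂]
    {P₁ : Set E₁} {P₂ : Set E₂} (hP₁ : IsSymmBody P₁) (hP₂ : IsSymmBody P₂) (c : ℝ) :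
    ∃ R, ∀ z : E₁ ⊗[ℝ] E₂, GramFactors P₁ P₂ z c → ‖z‖ ≤ R := by
  obtain ⟨r₁, hr₁, h₁⟩ := hP₁.polar.exists_closedBall_subset
  obtain ⟨r₂, hr₂, h₂⟩ := hP₂.polar.exists_closedBall_subset
  let e := stdOrthonormalBasis ℝ E₁
  let f := stdOrthonormalBasis ℝ E₂
  refine ⟨∑ _ij : Fin (Module.finrank ℝ E₁) × Fin (Module.finrank ℝ E₂), r₁⁻¹ * (r₂⁻¹ * c),
    fun z h => ?_⟩
  obtain ⟨H, _, _, _, A, B, hA, hB, hz⟩ := h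
  rw [← (e.tensorProduct f).sum_repr' z]
  refine norm_sum_le_of_le _ fun ij _ => ?_
  rw [norm_smul, (e.tensorProduct f).norm_eq_one, mul_one, OrthonormalBasis.tensorProduct_apply',
    hz]
  refine (abs_real_inner_le_norm _ _).trans ?_
  have hA' : ‖A (e ij.1)‖ ≤ r₁⁻¹ := by
    have := hA (r₁ • e ij.1) (h₁ (by simp [norm_smul, abs_of_pos hr₁]))
    rwa [map_smul, norm_smul, Real.norm_of_nonneg hr₁.le, ← le_inv_mul_iff₀ hr₁, mul_one] at this
  have hB' : ‖B (f ij.2)‖ ≤ r₂⁻¹ * c := by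
    have := hB (r₂ • f ij.2) (h₂ (by simp [norm_smul, abs_of_pos hr₂]))
    rwa [map_smul, norm_smul, Real.norm_of_nonneg hr₂.le, ← le_inv_mul_iff₀ hr₂] at this
  gcongr

lemma inner_tmul_map [FiniteDimensional ℝ E₁] [FiniteDimensional ℝ E₂] [FiniteDimensional ℝ F₁]
    [FiniteDimensional ℝ F₂] (T₁ : E₁ →ₗ[ℝ] F₁) (T₂ : E₂ →ₗ[ℝ] F₂) (z : E₁ ⊗[ℝ] E₂)
    (x : F₁) (y : F₂) : inner ℝ (x ⊗ₜ[ℝ] y) (TensorProduct.map T₁ T₂ z) =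
      inner ℝ (T₁.adjoint x ⊗ₜ[ℝ] T₂.adjoint y) z := by
  rw [← TensorProduct.map_tmul, ← TensorProduct.adjoint_map, LinearMap.adjoint_inner_left]

lemma adjoint_mem_polar [FiniteDimensional ℝ E₁] [FiniteDimensional ℝ F₁] {T : E₁ →ₗ[ℝ] F₁}
    {P : Set E₁} {Q : Set F₁} (h : T '' P ⊆ Q) {y : F₁} (hy : y ∈ polar Q) :
    T.adjoint y ∈ polar P := fun x hx => by
  rw [LinearMap.adjoint_inner_right]
  exact hy _ (h ⟨x, hx, rfl⟩)

lemma GramFactors.map [FiniteDimensional ℝ E₁] [FiniteDimensional ℝ E₂] [FiniteDimensional ℝ F₁]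
    [FiniteDimensional ℝ F₂] {T₁ : E₁ →ₗ[ℝ] F₁} {T₂ : E₂ →ₗ[ℝ] F₂} {P₁ : Set E₁} {P₂ : Set E₂}
    {Q₁ : Set F₁} {Q₂ : Set F₂} (h₁ : T₁ '' P₁ ⊆ Q₁) (h₂ : T₂ '' P₂ ⊆ Q₂) {z : E₁ ⊗[ℝ] E₂} {c : ℝ}
    (h : GramFactors P₁ P₂ z c) : GramFactors Q₁ Q₂ (TensorProduct.map T₁ T₂ z) c := by
  obtain ⟨H, _, _, _, A, B, hA, hB, hz⟩ := h
  exact ⟨H, _, _, ‹_›, A ∘ₗ T₁.adjoint, B ∘ₗ T₂.adjoint,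
    fun x hx => hA _ (adjoint_mem_polar h₁ hx), fun y hy => hB _ (adjoint_mem_polar h₂ hy),
    fun x y => by rw [inner_tmul_map, hz]; rfl⟩

/-- Restricting `A` and `B` to the subspaces is not enough: a point of the polar of a section need
not lie in the polar of the body, but it lifts there modulo the orthogonal complement. The form
ignores these complements, so `A` maps `M₁ᗮ` to vectors orthogonal to the range of `B`, and
symmetrically. Projecting those images away makes the lift harmless and leaves the form unchanged.
-/
lemma gramFactors_of_mapIncl [FiniteDimensional ℝ E₁] [FiniteDimensional ℝ E₂]
    {P₁ : Set E₁} {P₂ : Set E₂} (hP₁ : IsSymmBody P₁) (hP₂ : IsSymmBody P₂)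
    (M₁ : Submodule ℝ E₁) (M₂ : Submodule ℝ E₂) {z : M₁ ⊗[ℝ] M₂} {c : ℝ}
    (h : GramFactors P₁ P₂ (TensorProduct.mapIncl M₁ M₂ z) c) :
    GramFactors (M₁.subtype ⁻¹' P₁) (M₂.subtype ⁻¹' P₂) z c := by
  obtain ⟨H, _, _, _, A, B, hA, hB, hz⟩ := h
  have hadj : ∀ (M : Submodule ℝ E₁) (v : E₁), v ∈ Mᗮ → M.subtype.adjoint v = 0 := by
    intro M v hv
    refine ext_inner_left ℝ fun w => ?_
    rw [LinearMap.adjoint_inner_right, inner_zero_right]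
    exact hv w w.2
  have hadj' : ∀ (M : Submodule ℝ E₂) (v : E₂), v ∈ Mᗮ → M.subtype.adjoint v = 0 := by
    intro M v hv
    refine ext_inner_left ℝ fun w => ?_
    rw [LinearMap.adjoint_inner_right, inner_zero_right]
    exact hv w w.2
  have hz0 : ∀ x y, inner ℝ (A x) (B y) =
      inner ℝ (M₁.subtype.adjoint x ⊗ₜ[ℝ] M₂.subtype.adjoint y) z := by
    intro x y
    rw [← hz, TensorProduct.mapIncl, inner_tmul_map]
  let N₁ := (M₁ᗮ.map A)ᗮ
  let N₂ := (M₂ᗮ.map B)ᗮ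
  have hN₁ : ∀ v ∈ M₁ᗮ, N₁.starProjection (A v) = 0 := fun v hv => by
    rw [Submodule.starProjection_apply_eq_zero_iff]
    exact Submodule.le_orthogonal_orthogonal _ ⟨v, hv, rfl⟩
  have hN₂ : ∀ v ∈ M₂ᗮ, N₂.starProjection (B v) = 0 := fun v hv => by
    rw [Submodule.starProjection_apply_eq_zero_iff]
    exact Submodule.le_orthogonal_orthogonal _ ⟨v, hv, rfl⟩
  have hB₁ : ∀ y, B y ∈ N₁ := by
    rintro y _ ⟨v, hv, rfl⟩
    rw [hz0, hadj _ _ hv, TensorProduct.zero_tmul]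
    exact inner_zero_left (𝕜 := ℝ) z
  have hA₂ : ∀ x, A x ∈ N₂ := by
    rintro x _ ⟨v, hv, rfl⟩
    rw [real_inner_comm, hz0, hadj' _ _ hv, TensorProduct.tmul_zero]
    exact inner_zero_left (𝕜 := ℝ) z
  refine ⟨H, _, _, ‹_›, N₁.starProjection.toLinearMap ∘ₗ A ∘ₗ M₁.subtype,
    N₂.starProjection.toLinearMap ∘ₗ B ∘ₗ M₂.subtype, fun m hm => ?_, fun m hm => ?_, fun x y => ?_⟩
  · obtain ⟨x, hx, hxm⟩ := exists_mem_polar_sub_mem_orthogonal hP₁ M₁ hm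
    have : N₁.starProjection (A m) = N₁.starProjection (A x) := by
      have := hN₁ _ hxm
      rw [map_sub, map_sub, sub_eq_zero] at this
      exact this.symm
    exact (congrArg norm this).trans_le ((N₁.norm_starProjection_apply_le _).trans (hA x hx))
  · obtain ⟨x, hx, hxm⟩ := exists_mem_polar_sub_mem_orthogonal hP₂ M₂ hm
    have : N₂.starProjection (B m) = N₂.starProjection (B x) := by
      have := hN₂ _ hxm
      rw [map_sub, map_sub, sub_eq_zero] at this
      exact this.symm
    exact (congrArg norm this).trans_le ((N₂.norm_starProjection_apply_le _).trans (hB x hx))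
  · have hsub : ∀ (M : Submodule ℝ E₁) (m : M), M.subtype.adjoint (M.subtype m) = m := by
      intro M m
      refine ext_inner_left ℝ fun w => ?_
      rw [LinearMap.adjoint_inner_right]
      rfl
    have hsub' : ∀ (M : Submodule ℝ E₂) (m : M), M.subtype.adjoint (M.subtype m) = m := by
      intro M m
      refine ext_inner_left ℝ fun w => ?_
      rw [LinearMap.adjoint_inner_right]
      rfl
    have e1 : inner ℝ (x ⊗ₜ[ℝ] y) z = inner ℝ (A x) (B y) := by
      rw [hz0]
      exact congrArg₂ (fun a b => inner ℝ (a ⊗ₜ[ℝ] b) z) (hsub M₁ x).symm (hsub' M₂ y).symm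
    rw [e1]
    change _ = inner ℝ (N₁.starProjection (A x)) (N₂.starProjection (B y))
    -- This makes the second projection preserve `N₁`, so the first one can be dropped; the second
    -- is then moved onto `A x`, which it fixes.
    have hN : N₂ᗮ ≤ N₁ := by
      have h : M₂ᗮ.map B ≤ N₁ := by
        rintro _ ⟨v, -, rfl⟩
        exact hB₁ v
      have := Submodule.orthogonal_le (Submodule.orthogonal_le h)
      rwa [Submodule.triorthogonal_eq_orthogonal] at this
    have hmem : N₂.starProjection (B y) ∈ N₁ := by
      have := N₁.sub_mem (hB₁ y) (hN (N₂.sub_starProjection_mem_orthogonal (B y)))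
      rwa [sub_sub_cancel] at this
    rw [Submodule.inner_starProjection_left_eq_right, Submodule.starProjection_eq_self_iff.mpr hmem,
      ← Submodule.inner_starProjection_left_eq_right,
      Submodule.starProjection_eq_self_iff.mpr (hA₂ x)]

end Gram

/-! ### The Hilbertian norm through Gram representations -/

section Hilbertian

variable {E₁ E₂ : Type u}
  [NormedAddCommGroup E₁] [InnerProductSpace ℝ E₁] [NormedAddCommGroup E₂] [InnerProductSpace ℝ E₂]

lemma inner_tensorToHom (z : E₁ ⊗[ℝ] E₂) (x : E₁) (y : E₂) :
    inner ℝ (tensorToHom E₁ E₂ z (innerₗ E₁ x)) y = inner ℝ (x ⊗ₜ[ℝ] y) z := by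
  induction z using TensorProduct.induction_on with
  | zero => simp
  | tmul u v =>
    have h : tensorToHom E₁ E₂ (u ⊗ₜ v) (innerₗ E₁ x) = inner ℝ x u • v := rfl
    rw [h, real_inner_smul_left, TensorProduct.inner_tmul, real_inner_comm v y]
  | add z w hz hw => rw [map_add, LinearMap.add_apply, inner_add_left, hz, hw, inner_add_right]

lemma bddAbove_abs_dual [FiniteDimensional ℝ E₁] {P : Set E₁} (hP : IsSymmBody P)
    (φ : Module.Dual ℝ E₁) : BddAbove ((fun x => |φ x|) '' P) :=
  (hP.isCompact.image (φ.continuous_of_finiteDimensional.abs)).bddAbove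

lemma abs_le_dualNorm [FiniteDimensional ℝ E₁] {P : Set E₁} (hP : IsSymmBody P)
    (φ : Module.Dual ℝ E₁) {x : E₁} (hx : x ∈ P) : |φ x| ≤ dualNorm P φ :=
  le_csSup (bddAbove_abs_dual hP φ) ⟨x, hx, rfl⟩

lemma dualNorm_inner_le_one {P : Set E₁} (hP : IsSymmBody P) {x : E₁} (hx : x ∈ polar P) :
    dualNorm P (innerₗ E₁ x) ≤ 1 := by
  refine csSup_le (Set.Nonempty.image _ ⟨0, hP.zero_mem⟩) ?_
  rintro _ ⟨y, hy, rfl⟩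
  simpa [real_inner_comm] using hP.abs_inner_le_one hy hx

lemma exists_inner_eq [FiniteDimensional ℝ E₁] (φ : Module.Dual ℝ E₁) :
    ∃ x, innerₗ E₁ x = φ := by
  have := FiniteDimensional.complete ℝ E₁
  refine ⟨(InnerProductSpace.toDual ℝ E₁).symm (LinearMap.toContinuousLinearMap φ), ?_⟩
  ext y
  simp

lemma smul_mem_polar_of_dualNorm_le [FiniteDimensional ℝ E₁] {P : Set E₁} (hP : IsSymmBody P)
    {x : E₁} {d : ℝ} (hd : 0 < d) (h : dualNorm P (innerₗ E₁ x) ≤ d) : d⁻¹ • x ∈ polar P := by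
  intro y hy
  rw [real_inner_smul_right, inv_mul_le_iff₀ hd, mul_one, real_inner_comm]
  exact (le_abs_self _).trans ((abs_le_dualNorm hP (innerₗ E₁ x) hy).trans h)

lemma dualNorm_nonneg (P : Set E₁) (φ : Module.Dual ℝ E₁) : 0 ≤ dualNorm P φ :=
  Real.sSup_nonneg (by rintro _ ⟨x, -, rfl⟩; positivity)

/-- The set of products of bounds of the factorizations of `T_z` through Hilbert spaces. -/
def factorizationBounds (P₁ : Set E₁) (P₂ : Set E₂) (z : E₁ ⊗[ℝ] E₂) : Set ℝ :=
  {c | ∃ (H : Type u) (_ : NormedAddCommGroup H) (_ : InnerProductSpace ℝ H)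
    (_ : CompleteSpace H) (S : Module.Dual ℝ E₁ →ₗ[ℝ] H) (R : H →ₗ[ℝ] E₂) (a b : ℝ),
    0 ≤ a ∧ 0 ≤ b ∧ (∀ φ, ‖S φ‖ ≤ a * dualNorm P₁ φ) ∧ (∀ h, gauge P₂ (R h) ≤ b * ‖h‖) ∧
    tensorToHom E₁ E₂ z = R ∘ₗ S ∧ c = b * a}

variable [FiniteDimensional ℝ E₂]

/-- For a factorization `R ∘ S`, take `S` after the Riesz map and the adjoint of `R`, and move the
scalar `a` from the first factor to the second. -/
lemma gramFactors_of_mem_factorizationBounds {P₁ : Set E₁} {P₂ : Set E₂} (hP₁ : IsSymmBody P₁)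
    (hP₂ : IsSymmBody P₂) {z : E₁ ⊗[ℝ] E₂} {c : ℝ} (h : c ∈ factorizationBounds P₁ P₂ z) :
    GramFactors P₁ P₂ z c := by
  obtain ⟨H, _, _, _, S, R, a, b, ha, hb, hS, hR, hz, rfl⟩ := h
  have := FiniteDimensional.complete ℝ E₂
  have hR' : ∀ (h : H), ∀ y ∈ polar P₂, inner ℝ y (R h) ≤ b * ‖h‖ := fun h =>
    (hP₂.gauge_le_iff (by positivity)).mp (hR h)
  obtain ⟨r, hr, hball⟩ := hP₂.polar.exists_closedBall_subset
  -- `H` may be infinite-dimensional, so continuity of `R`, needed for the adjoint, has to come from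
  -- the gauge bound.
  have hbound : ∀ h : H, ‖R h‖ ≤ r⁻¹ * b * ‖h‖ := by
    intro h
    rcases eq_or_ne (R h) 0 with h0 | h0
    · rw [h0, norm_zero]
      positivity
    have hn : 0 < ‖R h‖ := norm_pos_iff.mpr h0
    have := hR' h ((r / ‖R h‖) • R h) (hball (by
      rw [mem_closedBall_zero_iff, norm_smul, Real.norm_of_nonneg (by positivity)]
      field_simp
      rfl))
    rw [real_inner_smul_left, real_inner_self_eq_norm_sq] at this
    have h2 : r / ‖R h‖ * ‖R h‖ ^ 2 = r * ‖R h‖ := by field_simp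
    rw [h2] at this
    rw [mul_assoc, inv_mul_eq_div, le_div_iff₀' hr]
    exact this
  let R' : H →L[ℝ] E₂ := R.mkContinuous _ hbound
  have hadj : ∀ y ∈ polar P₂, ‖R'.adjoint y‖ ≤ b := by
    intro y hy
    have h1 : inner ℝ (R'.adjoint y) (R'.adjoint y) ≤ b * ‖R'.adjoint y‖ := by
      rw [ContinuousLinearMap.adjoint_inner_left]
      exact hR' _ y hy
    rw [real_inner_self_eq_norm_sq] at h1
    nlinarith [norm_nonneg (R'.adjoint y)]
  have hinner : ∀ x y, inner ℝ (x ⊗ₜ[ℝ] y) z =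
      inner ℝ (S (innerₗ E₁ x)) (R'.adjoint y) := by
    intro x y
    rw [← inner_tensorToHom, hz, ContinuousLinearMap.adjoint_inner_right]
    rfl
  have hSx : ∀ x ∈ polar P₁, ‖S (innerₗ E₁ x)‖ ≤ a := fun x hx =>
    (hS _).trans (mul_le_of_le_one_right ha (dualNorm_inner_le_one hP₁ hx))
  -- Rescaling by `a⁻¹` fails for `a = 0`, but then `S`, and with it the form, vanishes.
  rcases ha.eq_or_lt with rfl | ha
  · refine ⟨H, _, _, ‹_›, 0, 0, by simp, by simp, fun x y => ?_⟩
    have : S (innerₗ E₁ x) = 0 := by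
      have := hS (innerₗ E₁ x)
      rwa [zero_mul, norm_le_zero_iff] at this
    rw [hinner, this]
    simp
  · refine ⟨H, _, _, ‹_›, a⁻¹ • S ∘ₗ innerₗ E₁, a • R'.adjoint.toLinearMap,
      fun x hx => ?_, fun y hy => ?_, fun x y => ?_⟩
    · simp only [LinearMap.smul_apply, LinearMap.comp_apply, norm_smul, norm_inv, Real.norm_eq_abs,
        abs_of_pos ha]
      rw [inv_mul_le_iff₀ ha, mul_one]
      exact hSx x hx
    · simp only [LinearMap.smul_apply, norm_smul, Real.norm_eq_abs, abs_of_pos ha]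
      rw [mul_comm]
      gcongr
      exact hadj y hy
    · rw [hinner]
      simp only [LinearMap.smul_apply, LinearMap.comp_apply, real_inner_smul_left,
        real_inner_smul_right, ContinuousLinearMap.coe_coe]
      rw [mul_inv_cancel_left₀ ha.ne']

variable [FiniteDimensional ℝ E₁]

lemma GramFactors.mem_factorizationBounds {P₁ : Set E₁} {P₂ : Set E₂} (hP₁ : IsSymmBody P₁)
    (hP₂ : IsSymmBody P₂) {z : E₁ ⊗[ℝ] E₂} {c : ℝ} (h : GramFactors P₁ P₂ z c) :
    c ∈ factorizationBounds P₁ P₂ z := by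
  have hc := h.nonneg
  obtain ⟨H, _, _, _, A, B, hA, hB, hz⟩ := h
  have := FiniteDimensional.complete ℝ E₁
  have := FiniteDimensional.complete ℝ E₂
  -- The inverse of the Riesz map `innerₗ`.
  let J : Module.Dual ℝ E₁ →ₗ[ℝ] E₁ :=
    (InnerProductSpace.toDual ℝ E₁).symm.toLinearEquiv.toLinearMap ∘ₗ
      LinearMap.toContinuousLinearMap.toLinearMap
  have hJ : ∀ φ, innerₗ E₁ (J φ) = φ := by
    intro φ
    ext y
    simp [J]
  let B' : E₂ →L[ℝ] H := LinearMap.toContinuousLinearMap B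
  refine ⟨H, _, _, ‹_›, A ∘ₗ J, B'.adjoint.toLinearMap, 1, c, zero_le_one, hc, fun φ => ?_,
    fun h => ?_, ?_, (mul_one c).symm⟩
  · rw [one_mul]
    refine le_of_forall_gt_imp_ge_of_dense fun d hd => ?_
    have hd0 : 0 < d := (dualNorm_nonneg _ _).trans_lt hd
    have := hA _ (smul_mem_polar_of_dualNorm_le hP₁ hd0 ((congrArg _ (hJ φ)).trans_le hd.le))
    rw [map_smul, norm_smul, norm_inv, Real.norm_of_nonneg hd0.le, inv_mul_le_iff₀ hd0,
      mul_one] at this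
    exact this
  · rw [hP₂.gauge_le_iff (by positivity)]
    intro y hy
    rw [ContinuousLinearMap.coe_coe, ContinuousLinearMap.adjoint_inner_right]
    exact (real_inner_le_norm _ _).trans (by gcongr; exact hB y hy)
  · ext φ
    obtain ⟨x, rfl⟩ := exists_inner_eq φ
    refine ext_inner_right ℝ fun y => ?_
    rw [inner_tensorToHom, hz, LinearMap.comp_apply, LinearMap.comp_apply,
      ContinuousLinearMap.coe_coe, ContinuousLinearMap.adjoint_inner_left]
    have : J (innerₗ E₁ x) = x := ext_inner_right ℝ fun y => LinearMap.congr_fun (hJ _) y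
    rw [this]
    rfl

/-- Every `c > 1` is allowed because attainment of the infimum is not established. Existence of some
factorization matters, as `sInf ∅ = 0`. -/
lemma mem_hilbertian_iff {P₁ : Set E₁} {P₂ : Set E₂} (hP₁ : IsSymmBody P₁)
    (hP₂ : IsSymmBody P₂) {z : E₁ ⊗[ℝ] E₂} :
    z ∈ hilbertian E₁ E₂ P₁ P₂ ↔ ∀ c > 1, GramFactors P₁ P₂ z c := by
  have hbdd : BddBelow (factorizationBounds P₁ P₂ z) :=
    ⟨0, fun c hc => (gramFactors_of_mem_factorizationBounds hP₁ hP₂ hc).nonneg⟩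
  have hne : (factorizationBounds P₁ P₂ z).Nonempty := by
    obtain ⟨C, -, hC⟩ := exists_gramFactors hP₁ hP₂
    exact ⟨_, (hC z).mem_factorizationBounds hP₁ hP₂⟩
  change sInf (factorizationBounds P₁ P₂ z) ≤ 1 ↔ _
  constructor
  · intro h c hc
    obtain ⟨d, hd, hdc⟩ := exists_lt_of_csInf_lt hne (h.trans_lt hc)
    exact (gramFactors_of_mem_factorizationBounds hP₁ hP₂ hd).mono hdc.le
  · intro h
    exact le_of_forall_gt_imp_ge_of_dense fun c hc =>
      csInf_le hbdd ((h c hc).mem_factorizationBounds hP₁ hP₂)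

lemma convex_hilbertian {P₁ : Set E₁} {P₂ : Set E₂} (hP₁ : IsSymmBody P₁)
    (hP₂ : IsSymmBody P₂) : Convex ℝ (hilbertian E₁ E₂ P₁ P₂) := by
  intro z hz w hw a b ha hb hab
  rw [mem_hilbertian_iff hP₁ hP₂] at *
  exact fun c hc => convex_gramFactors P₁ P₂ c (hz c hc) (hw c hc) ha hb hab

lemma projective_subset_hilbertian {P₁ : Set E₁} {P₂ : Set E₂} (hP₁ : IsSymmBody P₁)
    (hP₂ : IsSymmBody P₂) : projective E₁ E₂ P₁ P₂ ⊆ hilbertian E₁ E₂ P₁ P₂ := fun z hz => by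
  rw [mem_hilbertian_iff hP₁ hP₂]
  exact fun c hc => (projective_subset_gramFactors hP₁ hP₂ hz).mono hc.le

lemma hilbertian_subset_injective {P₁ : Set E₁} {P₂ : Set E₂} (hP₁ : IsSymmBody P₁)
    (hP₂ : IsSymmBody P₂) : hilbertian E₁ E₂ P₁ P₂ ⊆ injective E₁ E₂ P₁ P₂ := by
  intro z hz
  rw [mem_hilbertian_iff hP₁ hP₂] at hz
  have hsub : projective E₁ E₂ (polar P₁) (polar P₂) ⊆ polar {z} := by
    refine convexHull_min ?_ (convex_polar _)
    rintro _ ⟨x, hx, y, hy, rfl⟩ _ rfl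
    refine le_of_forall_gt_imp_ge_of_dense fun c hc => ?_
    obtain ⟨H, _, _, _, A, B, hA, hB, hz⟩ := hz c hc
    rw [real_inner_comm, hz]
    exact (real_inner_le_norm _ _).trans
      ((mul_le_of_le_one_left (norm_nonneg _) (hA x hx)).trans (hB y hy))
  intro w hw
  rw [real_inner_comm]
  exact hsub hw z rfl

lemma isSymmBody_hilbertian {P₁ : Set E₁} {P₂ : Set E₂} (hP₁ : IsSymmBody P₁)
    (hP₂ : IsSymmBody P₂) : IsSymmBody (hilbertian E₁ E₂ P₁ P₂) := by
  obtain ⟨C, hC, hball⟩ := exists_gramFactors hP₁ hP₂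
  obtain ⟨R, hR⟩ := GramFactors.exists_norm_le hP₁ hP₂ 2
  have hsub : Metric.closedBall 0 C⁻¹ ⊆ hilbertian E₁ E₂ P₁ P₂ := by
    intro z hz
    rw [mem_closedBall_zero_iff, ← one_div, le_div_iff₀' hC] at hz
    rw [mem_hilbertian_iff hP₁ hP₂]
    exact fun c hc => (hball z).mono (hz.trans hc.le)
  refine isSymmBody_of_closedBall (convex_hilbertian hP₁ hP₂) ?_ (fun z hz => ?_)
    (inv_pos.mpr hC) hsub
    (fun z hz => hR z ((mem_hilbertian_iff hP₁ hP₂).mp hz 2 one_lt_two))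
  · refine isClosed_of_closure_subset fun z hz => ?_
    rw [mem_hilbertian_iff hP₁ hP₂]
    intro c hc
    have hs : 1 < √c := by rwa [Real.lt_sqrt zero_le_one, one_pow]
    have h0 : 0 ∈ interior (hilbertian E₁ E₂ P₁ P₂) := mem_interior_iff_mem_nhds.mpr
      (Filter.mem_of_superset (Metric.closedBall_mem_nhds 0 (inv_pos.mpr hC)) hsub)
    -- A limit point is `√c` times an interior point; the slack `c` splits as one `√c` for the
    -- dilation and one for the bound at `w`.
    obtain ⟨w, hw, rfl⟩ :=
      (convex_hilbertian hP₁ hP₂).closure_subset_image_homothety_interior_of_one_lt h0 (√c) hs hz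
    have := ((mem_hilbertian_iff hP₁ hP₂).mp (interior_subset hw) (√c) hs).smul √c
    rw [abs_of_nonneg (by positivity), Real.mul_self_sqrt (by linarith)] at this
    rw [AffineMap.homothety_apply, vsub_eq_sub, sub_zero, vadd_eq_add, add_zero]
    exact this
  · rw [mem_hilbertian_iff hP₁ hP₂] at *
    intro c hc
    have := (hz c hc).smul (-1)
    rw [abs_neg, abs_one, one_mul] at this
    rwa [show -z = (-1 : ℝ) • z from (neg_one_smul ℝ z).symm]

end Hilbertian

/-! ### The Hilbertian product as a competitor in the injective hull -/

lemma isTensorProduct_hilbertian : IsTensorProduct hilbertian.{u} where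
  isSymmBody _ _ _ _ _ _ _ _ _ _ hP₁ hP₂ := isSymmBody_hilbertian hP₁ hP₂
  projective_below _ _ _ _ _ _ _ _ _ _ hP₁ hP₂ := projective_subset_hilbertian hP₁ hP₂
  below_injective _ _ _ _ _ _ _ _ _ _ hP₁ hP₂ := hilbertian_subset_injective hP₁ hP₂
  uniform := by
    rintro _ _ _ _ _ _ _ _ _ _ _ _ _ _ _ _ T₁ T₂ P₁ P₂ Q₁ Q₂ hP₁ hP₂ hQ₁ hQ₂ h₁ h₂ _ ⟨z, hz, rfl⟩
    rw [mem_hilbertian_iff hP₁ hP₂] at hz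
    rw [mem_hilbertian_iff hQ₁ hQ₂]
    exact fun c hc => (hz c hc).map h₁ h₂

lemma isInjective_hilbertian : IsInjective hilbertian.{u} := by
  intro E₁ E₂ _ _ _ _ _ _ P₁ P₂ M₁ M₂ hP₁ hP₂
  have h₁ := hP₁.preimage M₁.subtype M₁.injective_subtype
  have h₂ := hP₂.preimage M₂.subtype M₂.injective_subtype
  apply Set.Subset.antisymm
  · refine Set.subset_inter ?_ (Set.image_subset_range _ _)
    exact isTensorProduct_hilbertian.uniform _ _ _ _ M₁.subtype M₂.subtype _ _ _ _ h₁ h₂ hP₁ hP₂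
      (Set.image_preimage_subset _ _) (Set.image_preimage_subset _ _)
  · rintro _ ⟨hz, z, rfl⟩
    refine ⟨z, ?_, rfl⟩
    rw [mem_hilbertian_iff hP₁ hP₂] at hz
    rw [mem_hilbertian_iff h₁ h₂]
    exact fun c hc => gramFactors_of_mapIncl hP₁ hP₂ M₁ M₂ (hz c hc)

/-- The left side is the bipolar of the projective product. The Hilbertian body equals its own
bipolar, so closedness of the projective product is not needed. -/
lemma dual_injective_below_hilbertian : Below (dual injective.{u}) hilbertian := by
  intro E₁ E₂ _ _ _ _ _ _ P₁ P₂ hP₁ hP₂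
  have := FiniteDimensional.complete ℝ E₁
  have := FiniteDimensional.complete ℝ E₂
  have := FiniteDimensional.complete ℝ (E₁ ⊗[ℝ] E₂)
  have h : polar (polar (projective E₁ E₂ P₁ P₂)) ⊆ hilbertian E₁ E₂ P₁ P₂ := by
    rw [← (isSymmBody_hilbertian hP₁ hP₂).polar_polar]
    exact polar_anti (polar_anti (projective_subset_hilbertian hP₁ hP₂))
  rwa [dual, injective, hP₁.polar_polar, hP₂.polar_polar]

lemma dual_hilbertian_subset {E₁ E₂ : Type u}
    [NormedAddCommGroup E₁] [InnerProductSpace ℝ E₁] [FiniteDimensional ℝ E₁]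
    [NormedAddCommGroup E₂] [InnerProductSpace ℝ E₂] [FiniteDimensional ℝ E₂]
    (P₁ : Set E₁) (P₂ : Set E₂) :
    dual hilbertian E₁ E₂ P₁ P₂ ⊆ projHull injective E₁ E₂ P₁ P₂ :=
  polar_anti fun _ hz => hz hilbertian isTensorProduct_hilbertian isInjective_hilbertian
    dual_injective_below_hilbertian

/-! ### Grothendieck's inequality with a finite constant -/

section Grothendieck

/-- Rademacher sums: an isometric copy of Euclidean space in `L²` of a finite uniform probability
space, with the fourth moments controlled by the second ones. -/
lemma exists_rademacher_sums (d : ℕ) :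
    ∃ (Ω : Type) (_ : Fintype Ω) (_ : Nonempty Ω) (L : (Fin d → ℝ) → Ω → ℝ),
      (∀ a b, ∑ w, L a w * L b w = Fintype.card Ω * ∑ k, a k * b k) ∧
      ∀ a, ∑ w, L a w ^ 4 ≤ Fintype.card Ω * (3 * (∑ k, a k * a k) ^ 2) := by
  induction d with
  | zero => exact ⟨Unit, inferInstance, inferInstance, fun _ _ => 0, by simp, by simp⟩
  | succ d ih =>
    obtain ⟨Ω, _, _, L, h2, h4⟩ := ih
    refine ⟨Ω × Bool, inferInstance, inferInstance,
      fun a w => (if w.2 then a 0 else -a 0) + L (Fin.tail a) w.1, fun a b => ?_, fun a => ?_⟩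
    · simp only [Fintype.sum_prod_type, Fintype.sum_bool, Fintype.card_prod, Fintype.card_bool,
        Fin.sum_univ_succ, if_true, Bool.false_eq_true, if_false]
      have e : ∀ w, (a 0 + L (Fin.tail a) w) * (b 0 + L (Fin.tail b) w) +
          (-a 0 + L (Fin.tail a) w) * (-b 0 + L (Fin.tail b) w) =
          2 * (a 0 * b 0) + 2 * (L (Fin.tail a) w * L (Fin.tail b) w) := fun w => by ring
      simp only [e, Finset.sum_add_distrib, ← Finset.mul_sum, h2, Finset.sum_const,
        Finset.card_univ, nsmul_eq_mul, Fin.tail]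
      push_cast
      ring
    · simp only [Fintype.sum_prod_type, Fintype.sum_bool, Fintype.card_prod, Fintype.card_bool,
        Fin.sum_univ_succ, if_true, Bool.false_eq_true, if_false]
      -- Odd powers of the new sign cancel. With `s` the old sum of squares, the mean is at most `a
      -- 0 ^ 4 + 6 * a 0 ^ 2 * s + 3 * s ^ 2`, which is below `3 * (a 0 ^ 2 + s) ^ 2`.
      have e : ∀ w, (a 0 + L (Fin.tail a) w) ^ 4 + (-a 0 + L (Fin.tail a) w) ^ 4 =
          2 * a 0 ^ 4 + 12 * a 0 ^ 2 * (L (Fin.tail a) w * L (Fin.tail a) w) +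
            2 * L (Fin.tail a) w ^ 4 := fun w => by ring
      simp only [e, Finset.sum_add_distrib, ← Finset.mul_sum, h2, Finset.sum_const,
        Finset.card_univ, nsmul_eq_mul]
      have h := h4 (Fin.tail a)
      set s := ∑ k, Fin.tail a k * Fin.tail a k with hs
      have hs' : ∑ k : Fin d, a k.succ * a k.succ = s := rfl
      rw [hs']
      push_cast
      have hN : (0 : ℝ) ≤ Fintype.card Ω := by positivity
      have hp : 0 ≤ (Fintype.card Ω : ℝ) * a 0 ^ 4 := by positivity
      nlinarith

/-- Only the Gram matrix of the vectors matters, so any Hilbert space, in any universe, may be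
replaced by some `ℝ^d`. -/
lemma exists_euclidean_coordinates {ι H : Type*} [Finite ι] [NormedAddCommGroup H]
    [InnerProductSpace ℝ H] (v : ι → H) :
    ∃ (d : ℕ) (c : ι → EuclideanSpace ℝ (Fin d)), ∀ i j,
      inner ℝ (c i) (c j) = inner ℝ (v i) (v j) := by
  let W := Submodule.span ℝ (Set.range v)
  have : FiniteDimensional ℝ W := FiniteDimensional.span_of_finite ℝ (Set.finite_range v)
  let e := (stdOrthonormalBasis ℝ W).repr
  refine ⟨_, fun i => e ⟨v i, Submodule.subset_span ⟨i, rfl⟩⟩, fun i j => ?_⟩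
  rw [e.inner_map_map]
  rfl

/-- `K` bounds the bilinear form of `A` on unit balls of Hilbert spaces. -/
def IsHilbertBound {m n : ℕ} (A : Matrix (Fin m) (Fin n) ℝ) (K : ℝ) : Prop :=
  ∀ (H : Type) [NormedAddCommGroup H] [InnerProductSpace ℝ H] [CompleteSpace H]
    (x : Fin m → H) (y : Fin n → H), (∀ i, ‖x i‖ ≤ 1) → (∀ j, ‖y j‖ ≤ 1) →
    |∑ i, ∑ j, A i j * inner ℝ (x i) (y j)| ≤ K

/-- The bilinear form of `A` is bounded by `1` on the cubes. -/
def IsCubeContraction {ι κ : Type*} [Fintype ι] [Fintype κ] (A : Matrix ι κ ℝ) : Prop :=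
  ∀ (s : ι → ℝ) (t : κ → ℝ), (∀ i, |s i| ≤ 1) → (∀ j, |t j| ≤ 1) →
    |∑ i, ∑ j, A i j * s i * t j| ≤ 1

variable {m n : ℕ} {A : Matrix (Fin m) (Fin n) ℝ}

/-- A crude bound depending on `A`, so that a best bound for `A` exists and can be improved. -/
lemma isHilbertBound_sum_abs (A : Matrix (Fin m) (Fin n) ℝ) :
    IsHilbertBound A (∑ i, ∑ j, |A i j|) := by
  intro H _ _ _ x y hx hy
  refine (Finset.abs_sum_le_sum_abs _ _).trans (Finset.sum_le_sum fun i _ => ?_)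
  refine (Finset.abs_sum_le_sum_abs _ _).trans (Finset.sum_le_sum fun j _ => ?_)
  rw [abs_mul]
  refine mul_le_of_le_one_right (abs_nonneg _) ((abs_real_inner_le_norm _ _).trans ?_)
  exact mul_le_one₀ (hx i) (norm_nonneg _) (hy j)

lemma IsHilbertBound.nonneg {K : ℝ} (h : IsHilbertBound A K) : 0 ≤ K :=
  (abs_nonneg _).trans (h ℝ 0 0 (by simp) (by simp))

lemma IsHilbertBound.abs_sum_le {K : ℝ} (h : IsHilbertBound A K) {Ω : Type} [Fintype Ω]
    (X : Fin m → Ω → ℝ) (Y : Fin n → Ω → ℝ) {p q : ℝ} (hp : 0 < p) (hq : 0 < q)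
    (hX : ∀ i, ∑ w, X i w ^ 2 ≤ p ^ 2) (hY : ∀ j, ∑ w, Y j w ^ 2 ≤ q ^ 2) :
    |∑ i, ∑ j, A i j * ∑ w, X i w * Y j w| ≤ K * (p * q) := by
  have key := h (EuclideanSpace ℝ Ω) (fun i => p⁻¹ • WithLp.toLp 2 (X i))
    (fun j => q⁻¹ • WithLp.toLp 2 (Y j)) (fun i => ?_) (fun j => ?_)
  · have e : ∀ i j, A i j * ∑ w, X i w * Y j w = (p * q) * (A i j *
        inner ℝ (p⁻¹ • WithLp.toLp 2 (X i) : EuclideanSpace ℝ Ω) (q⁻¹ • WithLp.toLp 2 (Y j))) := by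
      intro i j
      rw [real_inner_smul_left, real_inner_smul_right, PiLp.inner_apply]
      simp only [RCLike.inner_apply, conj_trivial, mul_comm (Y _ _)]
      field_simp
    simp only [e, ← Finset.mul_sum]
    rw [abs_mul, abs_of_pos (mul_pos hp hq), mul_comm]
    gcongr
  · rw [norm_smul, norm_inv, Real.norm_of_nonneg hp.le, inv_mul_le_iff₀ hp, mul_one,
      EuclideanSpace.norm_eq]
    simpa using Real.sqrt_le_left hp.le |>.mpr (hX i)
  · rw [norm_smul, norm_inv, Real.norm_of_nonneg hq.le, inv_mul_le_iff₀ hq, mul_one,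
      EuclideanSpace.norm_eq]
    simpa using Real.sqrt_le_left hq.le |>.mpr (hY j)

lemma abs_clamp_le {M : ℝ} (hM : 0 ≤ M) (t : ℝ) : |max (-M) (min M t)| ≤ M :=
  abs_le.mpr ⟨le_max_left _ _, max_le (by linarith) (min_le_left _ _)⟩

lemma sq_clamp_le {M : ℝ} (hM : 0 ≤ M) (t : ℝ) : max (-M) (min M t) ^ 2 ≤ t ^ 2 := by
  rw [sq_le_sq]
  rcases le_total M t with h | h
  · rw [min_eq_left h, max_eq_right (by linarith), abs_of_nonneg hM, abs_of_nonneg (hM.trans h)]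
    exact h
  · rw [min_eq_right h]
    rcases le_total (-M) t with h' | h'
    · rw [max_eq_right h']
    · rw [max_eq_left h', abs_neg, abs_of_nonneg hM, abs_of_nonpos (by linarith)]
      linarith

/-- The error is zero for `|t| ≤ M` and `|t| - M` beyond, where both `M` and the error are at most
`|t|`. Fourth moments thus control the second moment of the truncated tail. -/
lemma sq_sub_clamp_le {M : ℝ} (hM : 0 ≤ M) (t : ℝ) :
    M ^ 2 * (t - max (-M) (min M t)) ^ 2 ≤ t ^ 4 := by
  rcases le_total M t with h | h
  · rw [min_eq_left h, max_eq_right (by linarith), show t ^ 4 = t ^ 2 * t ^ 2 by ring]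
    gcongr; linarith
  · rw [min_eq_right h]
    rcases le_total (-M) t with h' | h'
    · rw [max_eq_right h', sub_self, zero_pow two_ne_zero, mul_zero]
      positivity
    · rw [max_eq_left h', show t ^ 4 = (-t) ^ 2 * (-t) ^ 2 by ring,
        show (t - -M) ^ 2 = (-t - M) ^ 2 by ring]
      gcongr <;> linarith

/-- Truncating Rademacher sums improves any Hilbert bound that exceeds `98`. -/
lemma IsHilbertBound.truncate (hA : IsCubeContraction A) {K : ℝ} (h : IsHilbertBound A K) :
    IsHilbertBound A (49 + K / 2) := by
  intro H _ _ _ x y hx hy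
  obtain ⟨d, c, hc⟩ := exists_euclidean_coordinates (Sum.elim x y)
  obtain ⟨Ω, _, _, L, h2, h4⟩ := exists_rademacher_sums d
  have hcx : ∀ i j, inner ℝ (x i) (y j) = ∑ k, c (.inl i) k * c (.inr j) k := by
    intro i j
    have := hc (.inl i) (.inr j)
    rw [PiLp.inner_apply] at this
    simpa [mul_comm] using this.symm
  have hcs : ∀ i, ∑ k, c i k * c i k ≤ 1 := by
    intro i
    have h1 := hc i i
    have h2 : ‖Sum.elim x y i‖ ≤ 1 := by
      rcases i with i | i
      · exact hx i
      · exact hy i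
    rw [PiLp.inner_apply, real_inner_self_eq_norm_sq] at h1
    simp only [RCLike.inner_apply, conj_trivial] at h1
    rw [h1]
    exact pow_le_one₀ (norm_nonneg _) h2
  have hcs0 : ∀ i, 0 ≤ ∑ k, c i k * c i k :=
    fun i => Finset.sum_nonneg fun k _ => mul_self_nonneg _
  set N : ℝ := (Fintype.card Ω : ℝ) with hN
  have hN0 : 0 < N := by simp [hN, Fintype.card_pos]
  let X := fun i => L (c i)
  -- At level 7 the tail has mean square at most `3 / 49 < 1 / 16`, hence `L²` norm at most `1 / 4`.
  let T : ℝ → ℝ := fun t => max (-7) (min 7 t)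
  have hX2 : ∀ i, ∑ w, X i w ^ 2 ≤ √N ^ 2 := fun i => by
    simp only [Real.sq_sqrt hN0.le, pow_two (X i _)]
    rw [h2]
    exact mul_le_of_le_one_right hN0.le (hcs i)
  have hT2 : ∀ i, ∑ w, T (X i w) ^ 2 ≤ √N ^ 2 := fun i =>
    (Finset.sum_le_sum fun w _ => sq_clamp_le (by norm_num) _).trans (hX2 i)
  have hD2 : ∀ i, ∑ w, (X i w - T (X i w)) ^ 2 ≤ (√N / 4) ^ 2 := fun i => by
    have h1 : 7 ^ 2 * ∑ w, (X i w - T (X i w)) ^ 2 ≤ N * (3 * (∑ k, c i k * c i k) ^ 2) := by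
      rw [Finset.mul_sum]
      exact (Finset.sum_le_sum fun w _ => sq_sub_clamp_le (by norm_num) _).trans (h4 _)
    have h3 : (∑ k, c i k * c i k) ^ 2 ≤ 1 := pow_le_one₀ (hcs0 i) (hcs i)
    rw [div_pow, Real.sq_sqrt hN0.le]
    nlinarith
  have e1 := h.abs_sum_le (fun i w => X (.inl i) w - T (X (.inl i) w)) (fun j w => X (.inr j) w)
    (p := √N / 4) (q := √N) (by positivity) (by positivity) (fun i => hD2 _) (fun i => hX2 _)
  have e2 := h.abs_sum_le (fun i w => T (X (.inl i) w)) (fun j w => X (.inr j) w - T (X (.inr j) w))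
    (p := √N) (q := √N / 4) (by positivity) (by positivity) (fun i => hT2 _) (fun i => hD2 _)
  have e3 : |∑ i, ∑ j, A i j * ∑ w, T (X (.inl i) w) * T (X (.inr j) w)| ≤ N * 49 := by
    -- At each sample point the truncated values divided by 7 lie in the cube, so the contraction
    -- hypothesis applies pointwise and costs `7 ^ 2 = 49`.
    have hsw : ∑ i, ∑ j, A i j * ∑ w, T (X (.inl i) w) * T (X (.inr j) w) =
        ∑ w, 49 * ∑ i, ∑ j, A i j * (T (X (.inl i) w) / 7) * (T (X (.inr j) w) / 7) := by
      simp only [Finset.mul_sum]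
      rw [Finset.sum_comm' (t' := Finset.univ) (s' := fun _ => Finset.univ) (by simp)]
      simp only [Finset.sum_comm (s := (Finset.univ : Finset Ω))]
      rw [Finset.sum_comm]
      refine Finset.sum_congr rfl fun i _ => Finset.sum_congr rfl fun j _ =>
        Finset.sum_congr rfl fun w _ => by ring
    rw [hsw]
    refine (Finset.abs_sum_le_sum_abs _ _).trans
      ((Finset.sum_le_card_nsmul _ _ 49 fun w _ => ?_).trans_eq ?_)
    · rw [abs_mul, abs_of_nonneg (by norm_num)]
      refine mul_le_of_le_one_right (by norm_num) (hA _ _ (fun i => ?_) fun i => ?_) <;>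
      · rw [abs_div, abs_of_pos (by norm_num : (0 : ℝ) < 7), div_le_one (by norm_num)]
        exact abs_clamp_le (by norm_num) _
    · simp [hN]
  -- Each of the two error terms pairs a tail of norm at most `1 / 4` with a vector of norm at most
  -- one, contributing `K / 4`.
  have hdecomp : N * ∑ i, ∑ j, A i j * inner ℝ (x i) (y j) =
      (∑ i, ∑ j, A i j * ∑ w, T (X (.inl i) w) * T (X (.inr j) w)) +
      (∑ i, ∑ j, A i j * ∑ w, (X (.inl i) w - T (X (.inl i) w)) * X (.inr j) w) +
      ∑ i, ∑ j, A i j * ∑ w, T (X (.inl i) w) * (X (.inr j) w - T (X (.inr j) w)) := by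
    simp only [← Finset.sum_add_distrib, ← mul_add]
    rw [Finset.mul_sum]
    refine Finset.sum_congr rfl fun i _ => ?_
    rw [Finset.mul_sum]
    refine Finset.sum_congr rfl fun j _ => ?_
    rw [hcx, mul_left_comm, ← h2]
    congr 1
    exact Finset.sum_congr rfl fun w _ => by ring
  have hs : √N * √N = N := Real.mul_self_sqrt hN0.le
  have hs1 : K * (√N / 4 * √N) = N * (K / 4) := by
    rw [show K * (√N / 4 * √N) = √N * √N * (K / 4) by ring, hs]
  have hs2 : K * (√N * (√N / 4)) = N * (K / 4) := by
    rw [show K * (√N * (√N / 4)) = √N * √N * (K / 4) by ring, hs]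
  rw [hs1] at e1
  rw [hs2] at e2
  refine le_of_mul_le_mul_left ?_ hN0
  rw [← abs_of_pos hN0, ← abs_mul, hdecomp, abs_of_pos hN0]
  calc _ ≤ N * 49 + N * (K / 4) + N * (K / 4) := (abs_add_three _ _ _).trans (by gcongr)
    _ = _ := by ring

/-- Grothendieck's inequality with the constant `98`. -/
lemma isHilbertBound_of_isCubeContraction (hA : IsCubeContraction A) : IsHilbertBound A 98 := by
  have hbdd : BddBelow {K | IsHilbertBound A K} := ⟨0, fun K hK => IsHilbertBound.nonneg hK⟩
  have hne : {K | IsHilbertBound A K}.Nonempty := ⟨_, isHilbertBound_sum_abs A⟩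
  have hmem : IsHilbertBound A (sInf {K | IsHilbertBound A K}) := fun H _ _ _ x y hx hy =>
    le_csInf hne fun K hK => hK H x y hx hy
  -- The best bound `K` satisfies `K ≤ 49 + K / 2`.
  have hle : sInf {K | IsHilbertBound A K} ≤ 98 := by
    have := csInf_le hbdd (hmem.truncate hA)
    linarith
  exact fun H _ _ _ x y hx hy => (hmem H x y hx hy).trans hle

/-- The universal bound 98 makes the defining set nonempty; otherwise the infimum would be the
default value 0. -/
lemma isHilbertBound_grothendieckConstant (hA : IsCubeContraction A) :
    IsHilbertBound A grothendieckConstant := fun H _ _ _ x y hx hy =>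
  le_csInf ⟨98, fun _ _ _ hA => isHilbertBound_of_isCubeContraction hA⟩
    fun _ hK => hK _ _ A hA H x y hx hy

lemma one_le_grothendieckConstant : 1 ≤ grothendieckConstant := by
  have hA : IsCubeContraction (1 : Matrix (Fin 1) (Fin 1) ℝ) := fun s t hs ht => by
    simpa [abs_mul] using mul_le_one₀ (hs 0) (abs_nonneg _) (ht 0)
  simpa using isHilbertBound_grothendieckConstant hA ℝ (fun _ => 1) (fun _ => 1) (by simp) (by simp)

lemma abs_sum_inner_le_grothendieckConstant {ι κ H : Type*} [Fintype ι] [Fintype κ]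
    [NormedAddCommGroup H] [InnerProductSpace ℝ H] {A : Matrix ι κ ℝ} (hA : IsCubeContraction A)
    (x : ι → H) (y : κ → H) (hx : ∀ i, ‖x i‖ ≤ 1) (hy : ∀ j, ‖y j‖ ≤ 1) :
    |∑ i, ∑ j, A i j * inner ℝ (x i) (y j)| ≤ grothendieckConstant := by
  obtain ⟨d, c, hc⟩ := exists_euclidean_coordinates (Sum.elim x y)
  have hnorm : ∀ i, ‖c i‖ = ‖Sum.elim x y i‖ := fun i => by
    rw [@norm_eq_sqrt_real_inner _ _ _ (c i), hc, ← norm_eq_sqrt_real_inner]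
  let e := Fintype.equivFin ι
  let f := Fintype.equivFin κ
  have hA' : IsCubeContraction (A.submatrix e.symm f.symm) := fun s t hs ht => by
    have := hA (s ∘ e) (t ∘ f) (fun i => hs _) (fun i => ht _)
    rw [← e.symm.sum_comp] at this
    simpa only [← f.symm.sum_comp, Matrix.submatrix_apply, Function.comp_apply, Equiv.apply_symm_apply] using this
  have := isHilbertBound_grothendieckConstant hA' _ (fun i => c (.inl (e.symm i)))
    (fun j => c (.inr (f.symm j))) (fun i => (hnorm _).trans_le (hx _))
    (fun i => (hnorm _).trans_le (hy _))
  rw [← e.symm.sum_comp]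
  simpa only [← f.symm.sum_comp, Matrix.submatrix_apply, hc, Sum.elim_inl, Sum.elim_inr] using this

end Grothendieck

/-! ### Cubes: Grothendieck's inequality and near-embeddings -/

section Cube

/-- The unit ball of the supremum norm. -/
def cube (ι : Type*) : Set (EuclideanSpace ℝ ι) := {x | ∀ i, |x i| ≤ 1}

lemma isSymmBody_cube (ι : Type*) [Fintype ι] : IsSymmBody (cube ι) := by
  refine isSymmBody_of_closedBall (r := 1) (R := √(Fintype.card ι)) ?_ ?_ ?_ one_pos ?_ ?_
  · intro x hx y hy a b ha hb hab i
    calc |a * x i + b * y i| ≤ a * |x i| + b * |y i| := by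
          refine (abs_add_le _ _).trans_eq ?_
          rw [abs_mul, abs_mul, abs_of_nonneg ha, abs_of_nonneg hb]
      _ ≤ 1 := by nlinarith [hx i, hy i]
  · have : cube ι = ⋂ i, {x | |x i| ≤ 1} := by
      ext x
      simp [cube]
    rw [this]
    exact isClosed_iInter fun i => isClosed_le (by fun_prop) continuous_const
  · intro x hx i
    rw [PiLp.neg_apply, abs_neg]
    exact hx i
  · intro x hx i
    rw [mem_closedBall_zero_iff] at hx
    exact (PiLp.norm_apply_le x i).trans hx
  · intro x hx
    rw [EuclideanSpace.norm_eq]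
    refine Real.sqrt_le_sqrt ?_
    calc ∑ i, ‖x i‖ ^ 2 ≤ ∑ _i : ι, (1 : ℝ) :=
          Finset.sum_le_sum fun i _ => pow_le_one₀ (norm_nonneg _) (hx i)
      _ = Fintype.card ι := by simp

lemma basisFun_mem_polar_cube {ι : Type*} [Fintype ι] (i : ι) :
    EuclideanSpace.basisFun ι ℝ i ∈ polar (cube ι) := by
  classical
  intro x hx
  rw [EuclideanSpace.basisFun_apply, EuclideanSpace.inner_single_right]
  simpa using (le_abs_self _).trans (hx i)

lemma inner_eq_sum_basisFun {ι κ : Type*} [Fintype ι] [Fintype κ]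
    (z v : EuclideanSpace ℝ ι ⊗[ℝ] EuclideanSpace ℝ κ) :
    inner ℝ z v = ∑ i, ∑ j,
      inner ℝ (EuclideanSpace.basisFun ι ℝ i ⊗ₜ[ℝ] EuclideanSpace.basisFun κ ℝ j) v *
      inner ℝ (EuclideanSpace.basisFun ι ℝ i ⊗ₜ[ℝ] EuclideanSpace.basisFun κ ℝ j) z := by
  rw [← ((EuclideanSpace.basisFun ι ℝ).tensorProduct
    (EuclideanSpace.basisFun κ ℝ)).sum_inner_mul_inner, Fintype.sum_prod_type]
  refine Finset.sum_congr rfl fun i _ => Finset.sum_congr rfl fun j _ => ?_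
  rw [OrthonormalBasis.tensorProduct_apply, mul_comm, real_inner_comm z]

lemma isCubeContraction_of_mem_polar {ι κ : Type u} [Fintype ι] [Fintype κ]
    {v : EuclideanSpace ℝ ι ⊗[ℝ] EuclideanSpace ℝ κ}
    (hv : v ∈ polar (projective _ _ (cube ι) (cube κ))) :
    IsCubeContraction (Matrix.of fun i j =>
      inner ℝ (EuclideanSpace.basisFun ι ℝ i ⊗ₜ[ℝ] EuclideanSpace.basisFun κ ℝ j) v) := by
  classical
  intro s t hs ht
  let x : EuclideanSpace ℝ ι := WithLp.toLp 2 s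
  let y : EuclideanSpace ℝ κ := WithLp.toLp 2 t
  have hx : x ∈ cube ι := hs
  have hy : y ∈ cube κ := ht
  have e : (∑ i, ∑ j, Matrix.of (fun i j =>
      inner ℝ (EuclideanSpace.basisFun ι ℝ i ⊗ₜ[ℝ] EuclideanSpace.basisFun κ ℝ j) v) i j *
      s i * t j) = inner ℝ (x ⊗ₜ[ℝ] y) v := by
    rw [inner_eq_sum_basisFun]
    refine Finset.sum_congr rfl fun i _ => Finset.sum_congr rfl fun j _ => ?_
    rw [TensorProduct.inner_tmul, EuclideanSpace.basisFun_apply, EuclideanSpace.basisFun_apply,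
      EuclideanSpace.inner_single_left, EuclideanSpace.inner_single_left]
    simp [x, y, mul_assoc]
  rw [e, abs_le]
  constructor
  · have := hv ((-x) ⊗ₜ y) (subset_convexHull ℝ _ ⟨-x, (isSymmBody_cube ι).neg_mem hx, y, hy, rfl⟩)
    rw [TensorProduct.neg_tmul, inner_neg_left] at this
    linarith
  · exact hv _ (subset_convexHull ℝ _ ⟨x, hx, y, hy, rfl⟩)

/-- Grothendieck's inequality in terms of tensor products of cubes. -/
lemma inner_le_grothendieckConstant {ι κ : Type u} [Fintype ι] [Fintype κ]
    {z v : EuclideanSpace ℝ ι ⊗[ℝ] EuclideanSpace ℝ κ}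
    (hz : z ∈ hilbertian _ _ (cube ι) (cube κ))
    (hv : v ∈ polar (projective _ _ (cube ι) (cube κ))) :
    inner ℝ z v ≤ grothendieckConstant := by
  have hK : 0 < grothendieckConstant := zero_lt_one.trans_le one_le_grothendieckConstant
  refine le_of_forall_gt_imp_ge_of_dense fun d hd => ?_
  rw [mem_hilbertian_iff (isSymmBody_cube ι) (isSymmBody_cube κ)] at hz
  -- Membership gives factorizations only for constants above one, so the excess `c` is divided out
  -- of `B` and restored in the final bound.
  set c := d / grothendieckConstant with hc
  have hc1 : 1 < c := by rwa [hc, one_lt_div hK]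
  have hc0 : 0 < c := zero_lt_one.trans hc1
  obtain ⟨H, _, _, _, A, B, hA, hB, hz⟩ := hz c hc1
  have h := abs_sum_inner_le_grothendieckConstant (isCubeContraction_of_mem_polar hv)
    (fun i => A (EuclideanSpace.basisFun ι ℝ i))
    (fun j => c⁻¹ • B (EuclideanSpace.basisFun κ ℝ j))
    (fun i => hA _ (basisFun_mem_polar_cube i)) (fun j => by
      rw [norm_smul, norm_inv, Real.norm_of_nonneg hc0.le, inv_mul_le_iff₀ hc0, mul_one]
      exact hB _ (basisFun_mem_polar_cube j))
  have e : inner ℝ z v = c * ∑ i, ∑ j, Matrix.of (fun i j =>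
      inner ℝ (EuclideanSpace.basisFun ι ℝ i ⊗ₜ[ℝ] EuclideanSpace.basisFun κ ℝ j) v) i j *
      inner ℝ (A (EuclideanSpace.basisFun ι ℝ i)) (c⁻¹ • B (EuclideanSpace.basisFun κ ℝ j)) := by
    rw [inner_eq_sum_basisFun, Finset.mul_sum]
    refine Finset.sum_congr rfl fun i _ => ?_
    rw [Finset.mul_sum]
    refine Finset.sum_congr rfl fun j _ => ?_
    rw [real_inner_smul_right, hz, Matrix.of_apply]
    field_simp
  rw [e, show d = c * grothendieckConstant by rw [hc, div_mul_cancel₀ _ hK.ne']]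
  gcongr
  exact (le_abs_self _).trans h

/-- By the bipolar theorem it suffices to test against the polar of the `β` body, which lies in the
polar of the projective product. -/
lemma smul_mem_of_mem_hilbertian_cube {β : BodyProduct.{u}} (hβ : IsTensorProduct β)
    {ι κ : Type u} [Fintype ι] [Fintype κ] {z : EuclideanSpace ℝ ι ⊗[ℝ] EuclideanSpace ℝ κ}
    (hz : z ∈ hilbertian _ _ (cube ι) (cube κ)) :
    grothendieckConstant⁻¹ • z ∈ β _ _ (cube ι) (cube κ) := by
  have hK : 0 < grothendieckConstant := zero_lt_one.trans_le one_le_grothendieckConstant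
  have := FiniteDimensional.complete ℝ (EuclideanSpace ℝ ι ⊗[ℝ] EuclideanSpace ℝ κ)
  rw [← (hβ.isSymmBody _ _ _ _ (isSymmBody_cube ι) (isSymmBody_cube κ)).polar_polar]
  intro v hv
  rw [inner_tensor_smul_right, inv_mul_le_iff₀ hK, mul_one, real_inner_comm z v]
  exact inner_le_grothendieckConstant hz (polar_anti
    (hβ.projective_below _ _ _ _ (isSymmBody_cube ι) (isSymmBody_cube κ)) hv)

/-- A symmetric convex body is nearly a section of a cube. -/
lemma exists_cube_embedding {E : Type u} [NormedAddCommGroup E] [InnerProductSpace ℝ E]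
    [FiniteDimensional ℝ E] {P : Set E} (hP : IsSymmBody P) {s : ℝ} (hs : 1 < s) :
    ∃ (ι : Type u) (_ : Fintype ι) (T : E →ₗ[ℝ] EuclideanSpace ℝ ι), T '' P ⊆ cube ι ∧
      (∀ x, T x ∈ cube ι → s⁻¹ • x ∈ P) ∧ Function.Injective T := by
  have := FiniteDimensional.complete ℝ E
  have hs0 : 0 < s := zero_lt_one.trans hs
  set δ := 1 - s⁻¹ with hδ
  have hδ0 : 0 < δ := sub_pos.mpr (inv_lt_one_of_one_lt₀ hs)
  obtain ⟨r, hr, hball⟩ := hP.polar.exists_closedBall_subset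
  -- The centres of a finite `δ * r`-net of the polar serve as the coordinate functionals.
  obtain ⟨t, htP, htf, hcover⟩ := hP.polar.isCompact.finite_cover_balls (mul_pos hδ0 hr)
  let T : E →ₗ[ℝ] EuclideanSpace ℝ t :=
    (WithLp.linearEquiv 2 ℝ (t → ℝ)).symm.toLinearMap ∘ₗ LinearMap.pi fun f => innerₗ E (f : E)
  have hT : ∀ x f, T x f = inner ℝ (f : E) x := fun _ _ => rfl
  have hmem : ∀ x, T x ∈ cube t → s⁻¹ • x ∈ P := by
    intro x hx
    rw [← hP.polar_polar]
    obtain ⟨y, hy, hmax⟩ := hP.polar.isCompact.exists_isMaxOn ⟨0, zero_mem_polar P⟩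
      (f := fun y => inner ℝ y x) (by fun_prop)
    have hxy : inner ℝ y x ≤ s := by
      obtain ⟨f, hf, hyf⟩ := Set.mem_iUnion₂.mp (hcover hy)
      rw [mem_ball_iff_norm] at hyf
      have hw : δ⁻¹ • (y - f) ∈ polar P := hball (by
        rw [mem_closedBall_zero_iff, norm_smul, norm_inv, Real.norm_of_nonneg hδ0.le,
          inv_mul_le_iff₀ hδ0]
        exact hyf.le)
      -- Since `y` maximizes over the polar, replacing it by the net point `f` loses at most the
      -- fraction `δ` of the maximum, leaving `s⁻¹ * inner ℝ y x ≤ 1`.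
      have h1 : inner ℝ (δ⁻¹ • (y - f)) x ≤ inner ℝ y x := hmax hw
      rw [real_inner_smul_left, inv_mul_le_iff₀ hδ0, inner_sub_left] at h1
      have h2 : inner ℝ f x ≤ 1 := (le_abs_self _).trans (hx ⟨f, hf⟩)
      have h3 : s⁻¹ * inner ℝ y x ≤ 1 := by
        rw [hδ] at h1
        linarith
      rwa [inv_mul_le_iff₀ hs0, mul_one] at h3
    intro w hw
    rw [real_inner_smul_right, inv_mul_le_iff₀ hs0, mul_one]
    exact (hmax hw).trans hxy
  refine ⟨t, htf.fintype, T, ?_, hmem, ?_⟩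
  · rintro _ ⟨x, hx, rfl⟩ f
    rw [hT, real_inner_comm]
    exact hP.abs_inner_le_one hx (htP f.2)
  · rw [← LinearMap.ker_eq_bot, Submodule.eq_bot_iff]
    intro x hx
    rw [LinearMap.mem_ker] at hx
    obtain ⟨R, hR, hb⟩ := hP.exists_norm_le
    by_contra hx0
    have hn : 0 < ‖x‖ := norm_pos_iff.mpr hx0
    -- All multiples of a kernel vector map into the cube; this one would put a vector of norm `R +
    -- 1` in `P`.
    have h := hb _ (hmem ((s * (R + 1) / ‖x‖) • x) fun f => by rw [map_smul, hx]; simp)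
    rw [smul_smul, norm_smul, Real.norm_of_nonneg (by positivity)] at h
    have e : s⁻¹ * (s * (R + 1) / ‖x‖) * ‖x‖ = R + 1 := by field_simp
    linarith

end Cube

/-! ### From cubes to arbitrary bodies -/

/-- Push `z` into a product of cubes, apply the cube case, restrict to the ranges of the embeddings
by injectivity of `β`, and return by left inverses. The near-embeddings cost a factor `d > 1`,
removed by testing against the polar and letting `d` tend to one. -/
lemma smul_mem_of_mem_hilbertian {β : BodyProduct.{u}} (hβ : IsTensorProduct β)
    (hinj : IsInjective β) {E₁ E₂ : Type u}
    [NormedAddCommGroup E₁] [InnerProductSpace ℝ E₁] [FiniteDimensional ℝ E₁]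
    [NormedAddCommGroup E₂] [InnerProductSpace ℝ E₂] [FiniteDimensional ℝ E₂]
    {P₁ : Set E₁} {P₂ : Set E₂} (hP₁ : IsSymmBody P₁) (hP₂ : IsSymmBody P₂) {z : E₁ ⊗[ℝ] E₂}
    (hz : z ∈ hilbertian E₁ E₂ P₁ P₂) : grothendieckConstant⁻¹ • z ∈ β E₁ E₂ P₁ P₂ := by
  have := FiniteDimensional.complete ℝ (E₁ ⊗[ℝ] E₂)
  rw [← (hβ.isSymmBody _ _ _ _ hP₁ hP₂).polar_polar]
  intro v hv
  refine le_of_forall_gt_imp_ge_of_dense fun d hd => ?_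
  -- Each of the two embeddings may lose `√d`.
  have hs : 1 < √d := by rwa [Real.lt_sqrt zero_le_one, one_pow]
  have hd0 : 0 < d := zero_lt_one.trans hd
  obtain ⟨ι, _, T₁, hT₁, hT₁', hinj₁⟩ := exists_cube_embedding hP₁ hs
  obtain ⟨κ, _, T₂, hT₂, hT₂', hinj₂⟩ := exists_cube_embedding hP₂ hs
  obtain ⟨V₁, hV₁⟩ := T₁.exists_leftInverse_of_injective (LinearMap.ker_eq_bot.mpr hinj₁)
  obtain ⟨V₂, hV₂⟩ := T₂.exists_leftInverse_of_injective (LinearMap.ker_eq_bot.mpr hinj₂)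
  let M₁ := LinearMap.range T₁
  let M₂ := LinearMap.range T₂
  have hw : TensorProduct.map T₁ T₂ z ∈ hilbertian _ _ (cube ι) (cube κ) :=
    isTensorProduct_hilbertian.uniform _ _ _ _ T₁ T₂ _ _ _ _ hP₁ hP₂ (isSymmBody_cube ι)
      (isSymmBody_cube κ) hT₁ hT₂ ⟨z, hz, rfl⟩
  have hrange : grothendieckConstant⁻¹ • TensorProduct.map T₁ T₂ z ∈
      Set.range (TensorProduct.mapIncl M₁ M₂) := by
    refine ⟨grothendieckConstant⁻¹ • TensorProduct.map T₁.rangeRestrict T₂.rangeRestrict z, ?_⟩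
    rw [map_smul, TensorProduct.mapIncl, ← LinearMap.comp_apply, ← TensorProduct.map_comp]
    rfl
  have hmem := (hinj _ _ (cube ι) (cube κ) M₁ M₂ (isSymmBody_cube ι) (isSymmBody_cube κ)).superset
    ⟨smul_mem_of_mem_hilbertian_cube hβ hw, hrange⟩
  obtain ⟨q, hq, hqz⟩ := hmem
  have hU₁ : ((√d)⁻¹ • V₁ ∘ₗ M₁.subtype) '' (M₁.subtype ⁻¹' cube ι) ⊆ P₁ := by
    rintro _ ⟨⟨_, x, rfl⟩, hx, rfl⟩
    have : V₁ (T₁ x) = x := LinearMap.congr_fun hV₁ x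
    have h := hT₁' x hx
    rw [← this] at h
    exact h
  have hU₂ : ((√d)⁻¹ • V₂ ∘ₗ M₂.subtype) '' (M₂.subtype ⁻¹' cube κ) ⊆ P₂ := by
    rintro _ ⟨⟨_, x, rfl⟩, hx, rfl⟩
    have : V₂ (T₂ x) = x := LinearMap.congr_fun hV₂ x
    have h := hT₂' x hx
    rw [← this] at h
    exact h
  have hfin := hβ.uniform _ _ _ _ ((√d)⁻¹ • V₁ ∘ₗ M₁.subtype) ((√d)⁻¹ • V₂ ∘ₗ M₂.subtype) _ _ _ _
    ((isSymmBody_cube ι).preimage M₁.subtype M₁.injective_subtype)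
    ((isSymmBody_cube κ).preimage M₂.subtype M₂.injective_subtype) hP₁ hP₂ hU₁ hU₂ ⟨q, hq, rfl⟩
  have e : TensorProduct.map ((√d)⁻¹ • V₁ ∘ₗ M₁.subtype) ((√d)⁻¹ • V₂ ∘ₗ M₂.subtype) q =
      d⁻¹ • (grothendieckConstant⁻¹ • z) := by
    have h1 : TensorProduct.map (V₁ ∘ₗ M₁.subtype) (V₂ ∘ₗ M₂.subtype) q =
        grothendieckConstant⁻¹ • z := by
      rw [TensorProduct.map_comp, LinearMap.comp_apply]
      change TensorProduct.map V₁ V₂ (TensorProduct.mapIncl M₁ M₂ q) = _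
      rw [hqz, map_smul, ← LinearMap.comp_apply, ← TensorProduct.map_comp, hV₁, hV₂,
        TensorProduct.map_id, LinearMap.id_apply]
    rw [TensorProduct.map_smul_left, TensorProduct.map_smul_right, LinearMap.smul_apply,
      LinearMap.smul_apply, h1, smul_smul ((√d)⁻¹), ← mul_inv, Real.mul_self_sqrt hd0.le]
  rw [e] at hfin
  have := hv _ hfin
  rwa [real_inner_comm, inner_tensor_smul_right, inv_mul_le_iff₀ hd0, mul_one] at this

lemma projHull_injective_subset {E₁ E₂ : Type u}
    [NormedAddCommGroup E₁] [InnerProductSpace ℝ E₁] [FiniteDimensional ℝ E₁]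
    [NormedAddCommGroup E₂] [InnerProductSpace ℝ E₂] [FiniteDimensional ℝ E₂]
    {P₁ : Set E₁} {P₂ : Set E₂} (hP₁ : IsSymmBody P₁) (hP₂ : IsSymmBody P₂) :
    projHull injective E₁ E₂ P₁ P₂ ⊆ grothendieckConstant • dual hilbertian E₁ E₂ P₁ P₂ := by
  have hK : 0 < grothendieckConstant := zero_lt_one.trans_le one_le_grothendieckConstant
  intro w hw
  rw [Set.mem_smul_set_iff_inv_smul_mem₀ hK.ne']
  intro z hz
  -- The shrunk `z` lies in every injective tensor product, hence in the injective hull, against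
  -- which `w` is tested.
  have h := hw (grothendieckConstant⁻¹ • z) fun β hβ hinj _ =>
    smul_mem_of_mem_hilbertian hβ hinj hP₁.polar hP₂.polar hz
  rw [real_inner_comm, inner_tensor_smul_right, real_inner_comm z w] at h
  rwa [inner_tensor_smul_right]

end TensorBody

end

theorem mainTheorem5 (E₁ E₂ : Type u)
    [NormedAddCommGroup E₁] [InnerProductSpace ℝ E₁] [FiniteDimensional ℝ E₁]
    [NormedAddCommGroup E₂] [InnerProductSpace ℝ E₂] [FiniteDimensional ℝ E₂]
    (P₁ : Set E₁) (P₂ : Set E₂)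
    (hP₁ : TensorBody.IsSymmBody P₁) (hP₂ : TensorBody.IsSymmBody P₂) :
    TensorBody.dual TensorBody.hilbertian E₁ E₂ P₁ P₂ ⊆
        TensorBody.projHull TensorBody.injective E₁ E₂ P₁ P₂ ∧
      TensorBody.projHull TensorBody.injective E₁ E₂ P₁ P₂ ⊆
        TensorBody.grothendieckConstant •
          TensorBody.dual TensorBody.hilbertian E₁ E₂ P₁ P₂ :=
  ⟨TensorBody.dual_hilbertian_subset P₁ P₂, TensorBody.projHull_injective_subset hP₁ hP₂⟩
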